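/- Let $q\in\mathbb C^\times$ with $|q|\neq 1$, and let $T_q$ be the operator $f(z)\mapsto f(qz)$ on $\mathbb C[z,z^{-1}]$. Let $M_{ij}$ ($i,j\in\{1,2\}$) be the $2\times 2$ matrix units, with $M_{11},M_{22}$ even and $M_{12},M_{21}$ odd, and let $S\mathfrak S_q$ be the Lie superalgebra of finite sums of elements $z^kf(T_q)M_{ij}$ ($k\in\mathbb Z$, $f\in\mathbb C[w,w^{-1}]$), i.e. of $2\times2$ supermatrices of quantum pseudo-differential operators, with bracket the supercommutator for the product $(z^mF(T_q))(z^kG(T_q))=z^{m+k}F(q^kT_q)G(T_q)$. Let $\widehat{S\mathfrak S}_q=S\mathfrak S_q\oplus\mathbb C C$ be its central extension by the super 2-cocycle $\psi$ with $$\psi(z^rF(T_q),z^{-r}G(T_q))=\mathrm{Str}_0\big((1+\sigma+\cdots+\sigma^{r-1})(\sigma^{-r}(F)\,G)\big)\quad(r>0),$$ extended by super skew-symmetry to $r<0$, and $\psi(z^rF,z^sG)=0$ if $r+s\ne0$ or $r=s=0$; here $\sigma(F)(T_q)=F(qT_q)$, and $\mathrm{Str}_0(F)$ is the constant coefficient of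 $F_{11}$ minus that of $F_{22}$. The principal $\tfrac12\mathbb Z$-gradation gives $z^kf(T_q)M_{11}$ and $z^kf(T_q)M_{22}$ the degree $k$, $z^kf(T_q)M_{12}$ the degree $k+\tfrac12$, $z^kf(T_q)M_{21}$ the degree $k-\tfrac12$, and $C$ the degree $0$. Let $\lambda$ be a linear functional on the degree $0$ component, with labels $\Delta_{l,i}=-\lambda(T_q^lM_{ii})$ ($l\in\mathbb Z$, $i=1,2$), central charge $c=\lambda(C)$, and generating series $\Delta_{\lambda,i}(x)=\sum_{l\in\mathbb Z}\Delta_{l,i}x^{-l}$. Let $L(\lambda)$ be the irreducible ($\tfrac12\mathbb Z$-graded) highest weight module over $\widehat{S\mathfrak S}_q$ with highest weight $\lambda$. Then $L(\lambda)$ is quasifinite (all its graded components are finite-dimensional) if and only if one of the following equivalent conditions holds: (i) There are monic polynomials $b_{12}(x),b_{21}(x)\in\mathbb C[x]$ such that, as two-sided formal series, $$b_{12}(x)\big(\Delta_{\lambda,1}(q^{-1}x)+\Delta_{\lambda,2}(x)+c\big)=0,\qquad b_{21}(x)\big(\Delta_{\lambda,1}(x)+\Delta_{\lambda,2}(x)\big)=0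 .$$ (ii) There are quasipolynomials $P_{12},P_{21}$ (linear combinations of functions $p(x)e^{\alpha x}$ with $p\in\mathbb C[x]$, $\alpha\in\mathbb C$) such that $P_{12}(0)=P_{21}(0)+c$, $P_{21}(n)=\Delta_{n,1}+\Delta_{n,2}$ for all $n\in\mathbb Z$, and $P_{12}(n)=q^n\Delta_{n,1}+\Delta_{n,2}$ for all $n\in\mathbb Z$, $n\neq0$. -/

import Mathlib

open scoped LaurentPolynomial Polynomial

noncomputable section

namespace QPDO

/-! ### The superalgebra of 2×2 quantum pseudo-differential supermatrices -/

/-- `2 × 2` supermatrices `F(w) = ∑ f_{ij}(w) M_{ij}` with Laurent polynomial entries. The matrix unit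
`M_{ij}` of the usual numbering `i, j ∈ {1, 2}` has indices `i - 1, j - 1 : Fin 2`. -/
abbrev SMat : Type := Matrix (Fin 2) (Fin 2) ℂ[T;T⁻¹]

/-- Finite sums `∑_k z^k F_k(T_q)`; the element `z^k F(T_q)` is `Finsupp.single k F`. As `q` is
not a root of unity, the operators `z^k T_q^l` on `ℂ[z, z⁻¹]` are linearly independent, and so this is
the space of `2 × 2` matrices of quantum pseudo-differential operators. -/
abbrev SS : Type := ℤ →₀ SMat

/-- The underlying space of the central extension: `(X, a)` stands for `X + a C`. -/
abbrev SSHat : Type := SS × ℂ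

/-- The parity of the matrix unit `M_{ij}`. -/
def parity (i j : Fin 2) : ZMod 2 := if i = j then 0 else 1

/-- The component of parity `α` of a supermatrix. -/
def parityPart (α : ZMod 2) (F : SMat) : SMat :=
  Matrix.of fun i j => if parity i j = α then F i j else 0

/-- The sign `(-1)^{αβ}`. -/
def sgn (α β : ZMod 2) : ℂ := if α = 1 ∧ β = 1 then -1 else 1

/-- `f(w) ↦ f(q^k w)` on Laurent polynomials. -/
def dilate (q : ℂ) (k : ℤ) (f : ℂ[T;T⁻¹]) : ℂ[T;T⁻¹] :=
  f.coeff.sum fun l a => LaurentPolynomial.C (a * q ^ (k * l)) * LaurentPolynomial.T l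

/-- The power `σ^k` of the automorphism `σ(F)(T_q) = F(q T_q)` of supermatrices. -/
def sigma (q : ℂ) (k : ℤ) (F : SMat) : SMat := F.map (dilate q k)

/-- `Str_0(F) = (f_{11})_0 - (f_{22})_0`, where `(f)_0` is the constant coefficient. -/
def str0 (F : SMat) : ℂ := (F 0 0).coeff 0 - (F 1 1).coeff 0

/-- The super bracket of `z^r F` and `z^s G` without the central term, divided by `z^{r+s}`. Here
`(z^r F(T_q)) (z^s G(T_q)) = z^{r+s} F(q^s T_q) G(T_q)`, and the bracket of homogeneous elements of
parities `α`, `β` is `AB - (-1)^{αβ} BA`. -/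
def superComm (q : ℂ) (r s : ℤ) (F G : SMat) : SMat :=
  ∑ α : ZMod 2, ∑ β : ZMod 2,
    (sigma q s (parityPart α F) * parityPart β G
      - sgn α β • (sigma q r (parityPart β G) * parityPart α F))

/-- `Str_0((1 + σ + ⋯ + σ^{r-1})(σ^{-r}(F) G))`. -/
def psiPos (q : ℂ) (r : ℕ) (F G : SMat) : ℂ :=
  str0 (∑ m ∈ Finset.range r, sigma q m (sigma q (-(r : ℤ)) F * G))

/-- The super 2-cocycle `ψ(z^r F, z^s G)`: it is `psiPos q r F G` if `r = -s > 0`, it is determined by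
`ψ(A, B) = -(-1)^{αβ} ψ(B, A)` (for `A`, `B` of parities `α`, `β`) if `r = -s < 0`, and
it vanishes otherwise. -/
def psi (q : ℂ) (r s : ℤ) (F G : SMat) : ℂ :=
  if r = -s ∧ 0 < r then psiPos q r.toNat F G
  else if r = -s ∧ r < 0 then
    -∑ α : ZMod 2, ∑ β : ZMod 2,
      sgn α β * psiPos q s.toNat (parityPart β G) (parityPart α F)
  else 0

/-- The super bracket of the central extension, with `C = (0, 1)` central. -/
def bracket (q : ℂ) (A B : SSHat) : SSHat :=
  (A.1.sum fun r F => B.1.sum fun s G => Finsupp.single (r + s) (superComm q r s F G),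
   A.1.sum fun r F => B.1.sum fun s G => psi q r s F G)

/-- The even (`α = 0`) or odd (`α = 1`) part of the Lie superalgebra; `C` is even. -/
def parityPiece (α : ZMod 2) : Submodule ℂ SSHat where
  carrier := {A | (∀ k i j, A.1 k i j ≠ 0 → parity i j = α) ∧ (A.2 ≠ 0 → α = 0)}
  zero_mem' := by simp
  add_mem' := by
    rintro A B ⟨hA, hA'⟩ ⟨hB, hB'⟩
    refine ⟨fun k i j h => ?_, fun h => ?_⟩
    · by_cases h1 : A.1 k i j = 0
      · exact hB k i j (by simpa [h1] using h)
      · exact hA k i j h1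
    · by_cases h1 : A.2 = 0
      · exact hB' (by simpa [h1] using h)
      · exact hA' h1
  smul_mem' := by
    rintro c A ⟨hA, hA'⟩
    refine ⟨fun k i j h => hA k i j fun h0 => h (by simp [h0]), fun h => hA' fun h0 => h (by simp [h0])⟩

/-- The principal gradation. Degrees in `½ℤ` are doubled: `piece n` is the component of
degree `n/2`. The elements `z^k f(T_q) M_{11}` and `z^k f(T_q) M_{22}` have degree `k`,
`z^k f(T_q) M_{12}` has degree `k + 1/2`, `z^k f(T_q) M_{21}` has degree `k - 1/2`, and `C` has degree `0`. -/
def piece (n : ℤ) : Submodule ℂ SSHat where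
  carrier := {A | (∀ (k : ℤ) (i j : Fin 2), A.1 k i j ≠ 0 → 2 * k + ((j : ℕ) : ℤ) - ((i : ℕ) : ℤ) = n)
    ∧ (A.2 ≠ 0 → n = 0)}
  zero_mem' := by simp
  add_mem' := by
    rintro A B ⟨hA, hA'⟩ ⟨hB, hB'⟩
    refine ⟨fun k i j h => ?_, fun h => ?_⟩
    · by_cases h1 : A.1 k i j = 0
      · exact hB k i j (by simpa [h1] using h)
      · exact hA k i j h1
    · by_cases h1 : A.2 = 0
      · exact hB' (by simpa [h1] using h)
      · exact hA' h1
  smul_mem' := by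
    rintro c A ⟨hA, hA'⟩
    refine ⟨fun k i j h => hA k i j fun h0 => h (by simp [h0]), fun h => hA' fun h0 => h (by simp [h0])⟩

/-! ### Highest weight modules -/

section Modules

variable {V : Type*} [AddCommGroup V] [Module ℂ V]

/-- `V = ⨁ V_j` with the action `ρ` is a `½ℤ`-graded module over the Lie superalgebra;
`𝒱 n` is the component of degree `n/2`. -/
structure IsGradedModule (q : ℂ) (ρ : SSHat →ₗ[ℂ] Module.End ℂ V) (𝒱 : ℤ → Submodule ℂ V) :
    Prop where
  map_bracket : ∀ (α β : ZMod 2), ∀ A ∈ parityPiece α, ∀ B ∈ parityPiece β,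
    ρ (bracket q A B) = ρ A * ρ B - sgn α β • (ρ B * ρ A)
  isInternal : DirectSum.IsInternal 𝒱
  map_piece : ∀ m n : ℤ, ∀ A ∈ piece m, ∀ v ∈ 𝒱 n, ρ A v ∈ 𝒱 (m + n)

/-- `V` is a highest weight module with highest weight `lam`: there is `v ≠ 0` with `V_0 = ℂ v`,
`h v = lam(h) v` for `h` of degree `0`, `A v = 0` for `A` of positive degree, and
`U(g_-) v = V`, where the image of `U(g_-)` in `End V` is generated by the elements of negative degree. -/
structure IsHighestWeightModule (q : ℂ) (lam : Module.Dual ℂ (piece 0))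
    (ρ : SSHat →ₗ[ℂ] Module.End ℂ V) (𝒱 : ℤ → Submodule ℂ V) : Prop
    extends IsGradedModule q ρ 𝒱 where
  exists_vector : ∃ v : V, v ≠ 0 ∧ 𝒱 0 = Submodule.span ℂ {v} ∧
    (∀ h : piece 0, ρ h v = lam h • v) ∧
    (∀ n : ℤ, 0 < n → ∀ A ∈ piece n, ρ A v = 0) ∧
    (∀ w : V, ∃ u ∈ Algebra.adjoin ℂ {φ : Module.End ℂ V | ∃ n < 0, ∃ A ∈ piece n, φ = ρ A}, u v = w)

/-- `V` is the irreducible highest weight module `L(lam)`: a highest weight module whose only graded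
submodules are `0` and `V`. -/
structure IsIrreducibleHighestWeightModule (q : ℂ) (lam : Module.Dual ℂ (piece 0))
    (ρ : SSHat →ₗ[ℂ] Module.End ℂ V) (𝒱 : ℤ → Submodule ℂ V) : Prop
    extends IsHighestWeightModule q lam ρ 𝒱 where
  irreducible : ∀ W : Submodule ℂ V, (∀ A, ∀ w ∈ W, ρ A w ∈ W) → W = ⨆ n, W ⊓ 𝒱 n →
    W = ⊥ ∨ W = ⊤

/-- All graded components are finite-dimensional. -/
def IsQuasifinite (𝒱 : ℤ → Submodule ℂ V) : Prop := ∀ n, FiniteDimensional ℂ (𝒱 n)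

end Modules

/-! ### Labels, generating series and quasipolynomials -/

/-- `T_q^l M_{ii}`, as an element of degree `0`. -/
def diagElt (l : ℤ) (i : Fin 2) : piece 0 :=
  ⟨(Finsupp.single 0 (Matrix.single i i (LaurentPolynomial.T l)), 0), by
    refine ⟨fun k a b h => ?_, by simp⟩
    by_cases hk : k = 0
    · subst hk
      by_cases hab : i = a ∧ i = b
      · obtain ⟨rfl, rfl⟩ := hab; simp
      · exact absurd (by simp [hab]) h
    · exact absurd (by simp [Ne.symm hk]) h⟩

/-- The central element `C`, as an element of degree `0`. -/
def centralElt : piece 0 := ⟨(0, 1), by simp [piece]⟩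

/-- The labels `Δ_{l,i} = -lam(T_q^l M_{ii})`. -/
def label (lam : Module.Dual ℂ (piece 0)) (l : ℤ) (i : Fin 2) : ℂ := -lam (diagElt l i)

/-- The central charge `c = lam(C)`. -/
def centralCharge (lam : Module.Dual ℂ (piece 0)) : ℂ := lam centralElt

/-- Two-sided formal series `∑_{n ∈ ℤ} a_n x^n`, given by their coefficients. -/
abbrev BiSeries : Type := ℤ → ℂ

/-- The generating series `Δ_{lam,i}(x) = ∑_l Δ_{l,i} x^{-l}`. -/
def genSeries (lam : Module.Dual ℂ (piece 0)) (i : Fin 2) : BiSeries := fun n => label lam (-n) i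

/-- The substitution `a(x) ↦ a(u x)`. -/
def rescale (u : ℂ) (a : BiSeries) : BiSeries := fun n => u ^ n * a n

/-- A constant as a two-sided series. -/
def constSeries (c : ℂ) : BiSeries := fun n => if n = 0 then c else 0

/-- The product of a polynomial and a two-sided series. -/
def polyMul (b : ℂ[X]) (a : BiSeries) : BiSeries := fun n => b.sum fun k β => β * a (n - k)

/-- Quasipolynomials: linear combinations of functions `p(x) e^{αx}`, `p` a polynomial, `α ∈ ℂ`. -/
def IsQuasipolynomial (P : ℂ → ℂ) : Prop :=
  P ∈ Submodule.span ℂ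
    {g : ℂ → ℂ | ∃ (p : ℂ[X]) (α : ℂ), g = fun x => p.eval x * Complex.exp (α * x)}

end QPDO

end

noncomputable section

namespace QPDO

/-! ### Linear recurrences and quasipolynomials -/

/-! The degree `-1/2` part of the Lie superalgebra consists of the `z⁻¹ f M₁₂` and the `f M₂₁`, and
everything is decided there. Let `v` be the highest weight vector. Pairing these elements with
degree `1/2` on `v` produces the scalars `pairing₁₂` and `pairing₂₁`, functionals on Laurent
polynomials whose values on `T^n` are, up to sign, the coefficients of the two series in (i). Thus
(i) says that each functional kills the ideal of a nonzero polynomial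
(`polyMul_eq_zero_iff_forall_mul`).

Necessity: if the component of degree `-1/2` is finite-dimensional, some monic `b` gives `z⁻¹ b M₁₂
v = 0`, and similarly for `M₂₁`. Applying degree `1/2` elements shows that the functionals kill the
ideals of these polynomials.

Sufficiency: if the functionals kill these ideals, the vectors `z⁻¹ g b₁₂ M₁₂ v` and `g b₂₁ M₂₁ v`
are singular, hence zero by irreducibility (`eq_zero_of_singular`). Brackets carry such annihilating
ideals from degree `-1/2` to every negative degree (`mem_torsionVectors`); here `q` must not be a
root of unity. Vectors with this property form a submodule stable under negative degrees
(`mon_mem_torsionVectors`), so every vector has it. Each component is then finite-dimensional by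
induction on the degree, because `ℂ[T;T⁻¹]/(F)` is finite-dimensional for `F ≠ 0`.

The equivalence of (i) and (ii) is the theory of linear recurrences: a two-sided sequence is killed
by a nonzero polynomial in the shift exactly when it is the restriction of a quasipolynomial. -/

/-- The shift `u ↦ (n ↦ u (n + 1))` on two-sided sequences. -/
def shift : Module.End ℂ (ℤ → ℂ) := LinearMap.funLeft ℂ ℂ (· + 1)

@[simp]
lemma shift_apply (u : ℤ → ℂ) (n : ℤ) : shift u n = u (n + 1) := rfl

lemma shift_pow_apply (k : ℕ) (u : ℤ → ℂ) (n : ℤ) : (shift ^ k) u n = u (n + k) := by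
  induction k generalizing n with
  | zero => simp
  | succ k ih =>
    rw [pow_succ', Module.End.mul_apply, shift_apply, ih]
    congr 1
    push_cast
    ring

/-- Reading the coefficients backwards turns multiplication by `x` into the shift. -/
lemma polyMul_eq_zero_iff (b : ℂ[X]) (a : BiSeries) :
    polyMul b a = 0 ↔ Polynomial.aeval shift b (fun n => a (-n)) = 0 := by
  have key : ∀ n : ℤ, Polynomial.aeval shift b (fun n => a (-n)) n = polyMul b a (-n) := by
    intro n
    rw [Polynomial.aeval_def, Polynomial.eval₂_eq_sum, polyMul, Polynomial.sum, Polynomial.sum,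
      LinearMap.sum_apply, Finset.sum_apply]
    refine Finset.sum_congr rfl fun k _ => ?_
    rw [Module.End.mul_apply, Module.algebraMap_end_apply, Pi.smul_apply, shift_pow_apply,
      smul_eq_mul]
    congr 2
    ring
  constructor
  · intro h
    ext n
    rw [key, h]
    rfl
  · intro h
    ext n
    have := key (-n)
    rw [neg_neg] at this
    rw [← this, h]
    rfl

/-- The two-sided sequences satisfying a nontrivial linear recurrence with constant coefficients. -/
def recurrent : Submodule ℂ (ℤ → ℂ) where
  carrier := {u | ∃ b : ℂ[X], b ≠ 0 ∧ Polynomial.aeval shift b u = 0}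
  zero_mem' := ⟨1, one_ne_zero, map_zero _⟩
  add_mem' := by
    rintro u v ⟨b, hb, hu⟩ ⟨d, hd, hv⟩
    refine ⟨b * d, mul_ne_zero hb hd, ?_⟩
    rw [map_add]
    nth_rewrite 1 [mul_comm b d]
    rw [map_mul, map_mul, Module.End.mul_apply, Module.End.mul_apply, hu, hv, map_zero, map_zero,
      add_zero]
  smul_mem' := by
    rintro c u ⟨b, hb, hu⟩
    exact ⟨b, hb, by rw [map_smul, hu, smul_zero]⟩

lemma mem_recurrent_iff_monic {u : ℤ → ℂ} :
    u ∈ recurrent ↔ ∃ b : ℂ[X], b.Monic ∧ Polynomial.aeval shift b u = 0 := by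
  constructor
  · rintro ⟨b, hb, hu⟩
    refine ⟨Polynomial.C b.leadingCoeff⁻¹ * b, ?_, ?_⟩
    · rw [mul_comm]
      exact Polynomial.monic_mul_leadingCoeff_inv hb
    · rw [map_mul, Module.End.mul_apply, hu, map_zero]
  · rintro ⟨b, hb, hu⟩
    exact ⟨b, hb.ne_zero, hu⟩

lemma mem_recurrent_of_shift_sub {u : ℤ → ℂ} (β : ℂ) (h : shift u - β • u ∈ recurrent) :
    u ∈ recurrent := by
  obtain ⟨b, hb, hu⟩ := h
  refine ⟨b * (Polynomial.X - Polynomial.C β), mul_ne_zero hb (Polynomial.X_sub_C_ne_zero β), ?_⟩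
  rw [map_mul, Module.End.mul_apply, map_sub, Polynomial.aeval_X, Polynomial.aeval_C,
    LinearMap.sub_apply, Module.algebraMap_end_apply, hu]

/-- By the binomial theorem, `shift - β` lowers the degree of the polynomial factor, so strong
induction on `j` applies. -/
lemma pow_mul_zpow_mem_recurrent {β : ℂ} (hβ : β ≠ 0) (j : ℕ) :
    (fun n : ℤ => (n : ℂ) ^ j * β ^ n) ∈ recurrent := by
  induction j using Nat.strong_induction_on with
  | _ j ih =>
    refine mem_recurrent_of_shift_sub β ?_
    have : shift (fun n : ℤ => (n : ℂ) ^ j * β ^ n) - β • (fun n : ℤ => (n : ℂ) ^ j * β ^ n)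
        = ∑ i ∈ Finset.range j, (β * j.choose i) • fun n : ℤ => (n : ℂ) ^ i * β ^ n := by
      ext n
      rw [Finset.sum_apply]
      simp only [Pi.sub_apply, shift_apply, Pi.smul_apply, smul_eq_mul]
      push_cast
      rw [add_pow, Finset.sum_range_succ, zpow_add_one₀ hβ]
      simp only [one_pow, mul_one, Nat.choose_self, Nat.cast_one]
      rw [add_mul, Finset.sum_mul]
      have h2 : (n : ℂ) ^ j * (β ^ n * β) = β * ((n : ℂ) ^ j * β ^ n) := by ring
      rw [h2, add_sub_cancel_right]
      exact Finset.sum_congr rfl fun i _ => by ring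
    rw [this]
    exact Submodule.sum_mem _ fun i hi =>
      Submodule.smul_mem _ _ (ih i (Finset.mem_range.1 hi))

/-- Restriction of functions on `ℂ` to `ℤ`. -/
def restrictInt : (ℂ → ℂ) →ₗ[ℂ] (ℤ → ℂ) := LinearMap.funLeft ℂ ℂ (fun n : ℤ => (n : ℂ))

@[simp]
lemma restrictInt_apply (P : ℂ → ℂ) (n : ℤ) : restrictInt P n = P n := rfl

lemma restrictInt_mem_recurrent {P : ℂ → ℂ} (hP : IsQuasipolynomial P) :
    restrictInt P ∈ recurrent := by
  change P ∈ recurrent.comap restrictInt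
  refine Submodule.span_le.2 ?_ hP
  rintro _ ⟨p, α, rfl⟩
  have : restrictInt (fun x => p.eval x * Complex.exp (α * x))
      = ∑ i ∈ p.support, p.coeff i • fun n : ℤ => (n : ℂ) ^ i * Complex.exp α ^ n := by
    ext n
    rw [Finset.sum_apply, restrictInt_apply, Polynomial.eval_eq_sum, Polynomial.sum,
      Finset.sum_mul]
    refine Finset.sum_congr rfl fun i _ => ?_
    rw [mul_comm α, Complex.exp_int_mul, Pi.smul_apply, smul_eq_mul, mul_assoc]
  change _ ∈ recurrent
  rw [this]
  exact Submodule.sum_mem _ fun i _ =>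
    Submodule.smul_mem _ _ (pow_mul_zpow_mem_recurrent (Complex.exp_ne_zero α) i)

/-- The sequence `n ↦ n (n - 1) ⋯ (n - j + 1) β ^ n`. -/
def expPoch (j : ℕ) (β : ℂ) : ℤ → ℂ := fun n => (descPochhammer ℂ j).eval (n : ℂ) * β ^ n

/-- Falling factorials replace powers because their forward differences have a single term; the
shift then acts on the `expPoch j β` by a Jordan block. -/
lemma descPochhammer_succ_eval_add_one (j : ℕ) (x : ℂ) :
    (descPochhammer ℂ (j + 1)).eval (x + 1)
      = (descPochhammer ℂ (j + 1)).eval x + (j + 1) * (descPochhammer ℂ j).eval x := by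
  have := congrArg (Polynomial.eval (x + 1)) (descPochhammer_succ_comp_X_sub_one (R := ℂ) j)
  simp at this
  rw [this]
  ring

lemma shift_expPoch_zero {β : ℂ} (hβ : β ≠ 0) : shift (expPoch 0 β) = β • expPoch 0 β := by
  ext n
  simp only [expPoch, shift_apply, descPochhammer_zero, Polynomial.eval_one, one_mul,
    Pi.smul_apply, smul_eq_mul, zpow_add_one₀ hβ]
  ring

lemma shift_expPoch_succ {β : ℂ} (hβ : β ≠ 0) (j : ℕ) :
    shift (expPoch (j + 1) β) = β • expPoch (j + 1) β + (β * (j + 1)) • expPoch j β := by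
  ext n
  simp only [expPoch, shift_apply, Pi.add_apply, Pi.smul_apply, smul_eq_mul, zpow_add_one₀ hβ]
  push_cast
  rw [descPochhammer_succ_eval_add_one]
  ring

/-- The span of the sequences `expPoch j β` with `β ≠ 0`. -/
def expPolySeq : Submodule ℂ (ℤ → ℂ) :=
  Submodule.span ℂ {u | ∃ j β, β ≠ 0 ∧ u = expPoch j β}

lemma expPoch_mem {β : ℂ} (hβ : β ≠ 0) (j : ℕ) : expPoch j β ∈ expPolySeq :=
  Submodule.subset_span ⟨j, β, hβ, rfl⟩

/-- Surjectivity of `shift - β` on `expPolySeq`. For `γ = β` it lowers `j` by one up to a nonzero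
factor; for `γ ≠ β` it is triangular with diagonal entry `γ - β`. -/
lemma expPoch_mem_map_shift_sub (β : ℂ) {γ : ℂ} (hγ : γ ≠ 0) (j : ℕ) :
    expPoch j γ ∈ expPolySeq.map (shift - β • (1 : Module.End ℂ (ℤ → ℂ))) := by
  by_cases h : γ = β
  · subst h
    have hj : γ * ((j : ℂ) + 1) ≠ 0 := mul_ne_zero hγ (by exact_mod_cast Nat.succ_ne_zero j)
    refine ⟨(γ * ((j : ℂ) + 1))⁻¹ • expPoch (j + 1) γ,
      Submodule.smul_mem _ _ (expPoch_mem hγ _), ?_⟩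
    rw [map_smul, LinearMap.sub_apply, LinearMap.smul_apply, Module.End.one_apply,
      shift_expPoch_succ hγ, add_sub_cancel_left, smul_smul, inv_mul_cancel₀ hj, one_smul]
  · have h' : γ - β ≠ 0 := sub_ne_zero.2 h
    induction j with
    | zero =>
      refine ⟨(γ - β)⁻¹ • expPoch 0 γ, Submodule.smul_mem _ _ (expPoch_mem hγ _), ?_⟩
      rw [map_smul, LinearMap.sub_apply, LinearMap.smul_apply, Module.End.one_apply,
        shift_expPoch_zero hγ, ← sub_smul, smul_smul, inv_mul_cancel₀ h', one_smul]
    | succ j ih =>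
      have : expPoch (j + 1) γ = (γ - β)⁻¹ •
          ((shift - β • (1 : Module.End ℂ (ℤ → ℂ))) (expPoch (j + 1) γ)
            - (γ * (j + 1)) • expPoch j γ) := by
        rw [LinearMap.sub_apply, LinearMap.smul_apply, Module.End.one_apply,
          shift_expPoch_succ hγ, add_sub_right_comm, add_sub_cancel_right, ← sub_smul, smul_smul,
          inv_mul_cancel₀ h', one_smul]
      rw [this]
      exact Submodule.smul_mem _ _ (Submodule.sub_mem _
        (Submodule.mem_map_of_mem (expPoch_mem hγ _)) (Submodule.smul_mem _ _ ih))

lemma mem_expPolySeq_of_shift_eq_smul {u : ℤ → ℂ} {β : ℂ} (h : shift u = β • u) :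
    u ∈ expPolySeq := by
  have h' : ∀ n, u (n + 1) = β * u n := fun n => congrFun h n
  -- A root `0` of the recurrence contributes nothing, since the shift is injective on two-sided
  -- sequences.
  by_cases hβ : β = 0
  · have : u = 0 := by
      ext n
      simpa [hβ] using h' (n - 1)
    rw [this]
    exact Submodule.zero_mem _
  · have : u = u 0 • expPoch 0 β := by
      ext n
      simp only [expPoch, descPochhammer_zero, Polynomial.eval_one, one_mul, Pi.smul_apply,
        smul_eq_mul]
      induction n using Int.induction_on with
      | zero => simp
      | succ n ih =>
        rw [h', ih, zpow_add_one₀ hβ]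
        ring
      | pred n ih =>
        have := h' (-n - 1)
        rw [sub_add_cancel, ih] at this
        apply mul_left_cancel₀ hβ
        rw [← this, zpow_sub_one₀ hβ]
        field_simp
    rw [this]
    exact Submodule.smul_mem _ _ (expPoch_mem hβ 0)

/-- By surjectivity some `w` in `expPolySeq` has the same image as `u` under `shift - β`, and `u -
w` is geometric. -/
lemma mem_expPolySeq_of_shift_sub {u : ℤ → ℂ} (β : ℂ) (h : shift u - β • u ∈ expPolySeq) :
    u ∈ expPolySeq := by
  have hle : expPolySeq ≤ expPolySeq.map (shift - β • (1 : Module.End ℂ (ℤ → ℂ))) := by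
    refine Submodule.span_le.2 ?_
    rintro _ ⟨j, γ, hγ, rfl⟩
    exact expPoch_mem_map_shift_sub β hγ j
  obtain ⟨w, hw, hwu⟩ := hle h
  rw [LinearMap.sub_apply, LinearMap.smul_apply, Module.End.one_apply] at hwu
  have : u - w ∈ expPolySeq := by
    refine mem_expPolySeq_of_shift_eq_smul (β := β) ?_
    rw [map_sub, smul_sub]
    linear_combination -hwu
  simpa using Submodule.add_mem _ this hw

lemma recurrent_le_expPolySeq : recurrent ≤ expPolySeq := by
  suffices ∀ (d : ℕ) (b : ℂ[X]) (u : ℤ → ℂ), b.natDegree = d → b ≠ 0 →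
      Polynomial.aeval shift b u = 0 → u ∈ expPolySeq by
    rintro u ⟨b, hb, hu⟩
    exact this _ b u rfl hb hu
  intro d
  induction d with
  | zero =>
    intro b u hd hb hu
    rw [Polynomial.eq_C_of_natDegree_eq_zero hd] at hb hu
    rw [Polynomial.aeval_C, Module.algebraMap_end_apply, smul_eq_zero] at hu
    rw [hu.resolve_left fun h => hb (by rw [h, map_zero])]
    exact Submodule.zero_mem _
  | succ d ih =>
    intro b u hd hb hu
    obtain ⟨β, hβ⟩ := IsAlgClosed.exists_root b
      (by rw [Polynomial.degree_eq_natDegree hb, hd]; exact_mod_cast Nat.succ_ne_zero d)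
    obtain ⟨b', rfl⟩ := Polynomial.dvd_iff_isRoot.2 hβ
    have hb' : b' ≠ 0 := right_ne_zero_of_mul hb
    refine mem_expPolySeq_of_shift_sub β (ih b' _ ?_ hb' ?_)
    · rw [Polynomial.natDegree_mul (Polynomial.X_sub_C_ne_zero β) hb',
        Polynomial.natDegree_X_sub_C] at hd
      omega
    · rw [mul_comm, map_mul, Module.End.mul_apply, map_sub, Polynomial.aeval_X,
        Polynomial.aeval_C, LinearMap.sub_apply, Module.algebraMap_end_apply] at hu
      exact hu

lemma mem_recurrent_iff_quasipolynomial {u : ℤ → ℂ} :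
    u ∈ recurrent ↔ ∃ P : ℂ → ℂ, IsQuasipolynomial P ∧ ∀ n : ℤ, P n = u n := by
  constructor
  · intro hu
    have hle : expPolySeq ≤ (Submodule.span ℂ {g : ℂ → ℂ | ∃ (p : ℂ[X]) (α : ℂ),
        g = fun x => p.eval x * Complex.exp (α * x)}).map restrictInt := by
      refine Submodule.span_le.2 ?_
      rintro _ ⟨j, β, hβ, rfl⟩
      -- Any logarithm of `β` would do, as only integer arguments matter.
      refine ⟨_, Submodule.subset_span ⟨descPochhammer ℂ j, Complex.log β, rfl⟩, ?_⟩
      ext n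
      rw [restrictInt_apply, expPoch, mul_comm (Complex.log β), Complex.exp_int_mul,
        Complex.exp_log hβ]
    obtain ⟨P, hP, rfl⟩ := hle (recurrent_le_expPolySeq hu)
    exact ⟨P, hP, fun n => rfl⟩
  · rintro ⟨P, hP, h⟩
    have : restrictInt P = u := funext h
    exact this ▸ restrictInt_mem_recurrent hP

lemma exists_monic_polyMul_eq_zero_iff {a : BiSeries} :
    (∃ b : ℂ[X], b.Monic ∧ polyMul b a = 0) ↔
      ∃ P : ℂ → ℂ, IsQuasipolynomial P ∧ ∀ n : ℤ, P n = a (-n) := by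
  simp only [polyMul_eq_zero_iff]
  rw [← mem_recurrent_iff_monic, mem_recurrent_iff_quasipolynomial]

/-- The equivalence of the conditions (i) and (ii) on the labels. -/
lemma exists_polyMul_iff_exists_quasipolynomial (q : ℂ) (lam : Module.Dual ℂ (piece 0)) :
    (∃ b₁₂ b₂₁ : Polynomial ℂ, b₁₂.Monic ∧ b₂₁.Monic ∧
        polyMul b₁₂ (rescale q⁻¹ (genSeries lam 0) + genSeries lam 1
          + constSeries (centralCharge lam)) = 0 ∧
        polyMul b₂₁ (genSeries lam 0 + genSeries lam 1) = 0) ↔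
      ∃ P₁₂ P₂₁ : ℂ → ℂ, IsQuasipolynomial P₁₂ ∧ IsQuasipolynomial P₂₁ ∧
        P₁₂ 0 = P₂₁ 0 + centralCharge lam ∧
        (∀ n : ℤ, P₂₁ n = label lam n 0 + label lam n 1) ∧
        (∀ n : ℤ, n ≠ 0 → P₁₂ n = q ^ n * label lam n 0 + label lam n 1) := by
  have h1 := exists_monic_polyMul_eq_zero_iff (a := rescale q⁻¹ (genSeries lam 0)
    + genSeries lam 1 + constSeries (centralCharge lam))
  have h2 := exists_monic_polyMul_eq_zero_iff (a := genSeries lam 0 + genSeries lam 1)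
  simp only [Pi.add_apply, rescale, genSeries, constSeries, neg_neg, inv_zpow', neg_eq_zero]
    at h1 h2
  constructor
  · rintro ⟨b₁, b₂, hb₁, hb₂, e₁, e₂⟩
    obtain ⟨P₁, hP₁, f₁⟩ := h1.1 ⟨b₁, hb₁, e₁⟩
    obtain ⟨P₂, hP₂, f₂⟩ := h2.1 ⟨b₂, hb₂, e₂⟩
    refine ⟨P₁, P₂, hP₁, hP₂, ?_, f₂, fun n hn => by simpa [hn] using f₁ n⟩
    -- At `n = 0` the factor `q ^ n` is `1` and the constant series contributes `c`, so the two
    -- quasipolynomials differ there by `c`.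
    have g₁ := f₁ 0
    have g₂ := f₂ 0
    simp only [Int.cast_zero, zpow_zero, one_mul, if_true] at g₁ g₂
    rw [g₁, g₂]
  · rintro ⟨P₁, P₂, hP₁, hP₂, e, f₂, f₁⟩
    obtain ⟨b₂, hb₂, e₂⟩ := h2.2 ⟨P₂, hP₂, f₂⟩
    obtain ⟨b₁, hb₁, e₁⟩ := h1.2 ⟨P₁, hP₁, fun n => by
      by_cases hn : n = 0
      · subst hn
        have g₂ := f₂ 0
        rw [Int.cast_zero] at g₂ ⊢
        rw [e, g₂]
        simp
      · simpa [hn] using f₁ n hn⟩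
    exact ⟨b₁, b₂, hb₁, hb₂, e₁, e₂⟩

/-! ### Dilations of Laurent polynomials -/

/-- `dilate q k` as an algebra homomorphism, for `q ≠ 0`. -/
def dilateHom {q : ℂ} (hq : q ≠ 0) (k : ℤ) : ℂ[T;T⁻¹] →ₐ[ℂ] ℂ[T;T⁻¹] :=
  AddMonoidAlgebra.lift ℂ ℂ[T;T⁻¹] ℤ
    { toFun := fun l => LaurentPolynomial.C (q ^ (k * l.toAdd)) * LaurentPolynomial.T l.toAdd
      map_one' := by simp
      map_mul' := fun a b => by
        rw [toAdd_mul, mul_add, zpow_add₀ hq, map_mul, LaurentPolynomial.T_add]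
        ring }

lemma dilate_eq_dilateHom {q : ℂ} (hq : q ≠ 0) (k : ℤ) (f : ℂ[T;T⁻¹]) :
    dilate q k f = dilateHom hq k f := by
  rw [dilateHom, AddMonoidAlgebra.lift_apply, dilate]
  refine Finsupp.sum_congr fun l _ => ?_
  rw [LaurentPolynomial.smul_eq_C_mul, MonoidHom.coe_mk, OneHom.coe_mk, map_mul, mul_assoc]
  rfl

@[simp]
lemma dilateHom_T {q : ℂ} (hq : q ≠ 0) (k l : ℤ) :
    dilateHom hq k (LaurentPolynomial.T l) = q ^ (k * l) • LaurentPolynomial.T l := by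
  rw [dilateHom, LaurentPolynomial.T, AddMonoidAlgebra.lift_single, one_smul,
    LaurentPolynomial.smul_eq_C_mul]
  rfl

lemma laurent_linearMap_ext {M : Type*} [AddCommMonoid M] [Module ℂ M]
    {φ ψ : ℂ[T;T⁻¹] →ₗ[ℂ] M}
    (h : ∀ n, φ (LaurentPolynomial.T n) = ψ (LaurentPolynomial.T n)) : φ = ψ := by
  refine LinearMap.ext fun f => ?_
  induction f using LaurentPolynomial.induction_on' with
  | add p q hp hq => rw [map_add, map_add, hp, hq]
  | C_mul_T n a => rw [← LaurentPolynomial.smul_eq_C_mul, map_smul, map_smul, h]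

lemma dilateHom_dilateHom {q : ℂ} (hq : q ≠ 0) (k l : ℤ) (f : ℂ[T;T⁻¹]) :
    dilateHom hq k (dilateHom hq l f) = dilateHom hq (k + l) f := by
  have : (dilateHom hq k).toLinearMap ∘ₗ (dilateHom hq l).toLinearMap
      = (dilateHom hq (k + l)).toLinearMap := by
    refine laurent_linearMap_ext fun n => ?_
    simp only [LinearMap.comp_apply, AlgHom.toLinearMap_apply, dilateHom_T, map_smul, smul_smul]
    rw [← zpow_add₀ hq]
    congr 2
    ring
  exact LinearMap.congr_fun this f

@[simp]
lemma dilateHom_zero {q : ℂ} (hq : q ≠ 0) (f : ℂ[T;T⁻¹]) : dilateHom hq 0 f = f := by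
  have : (dilateHom hq 0).toLinearMap = LinearMap.id := by
    refine laurent_linearMap_ext fun n => ?_
    simp
  exact LinearMap.congr_fun this f

lemma dilateHom_ne_zero {q : ℂ} (hq : q ≠ 0) (k : ℤ) {f : ℂ[T;T⁻¹]} (hf : f ≠ 0) :
    dilateHom hq k f ≠ 0 := by
  intro h
  apply hf
  have := dilateHom_dilateHom hq (-k) k f
  rwa [h, map_zero, neg_add_cancel, dilateHom_zero, eq_comm] at this

/-! ### Brackets of monomials -/

/-- The element `z^k f(T_q) M_{ij}` of the central extension. -/
def mon (k : ℤ) (i j : Fin 2) : ℂ[T;T⁻¹] →ₗ[ℂ] SSHat :=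
  LinearMap.inl ℂ SS ℂ ∘ₗ Finsupp.lsingle k ∘ₗ Matrix.singleLinearMap ℂ i j

lemma mon_apply (k : ℤ) (i j : Fin 2) (f : ℂ[T;T⁻¹]) :
    mon k i j f = (Finsupp.single k (Matrix.single i j f), 0) := rfl

/-- Twice the degree of `z^k f(T_q) M_{ij}`. -/
def deg (k : ℤ) (i j : Fin 2) : ℤ := 2 * k + ((j : ℕ) : ℤ) - ((i : ℕ) : ℤ)

/-- The central element `C` of the central extension. -/
def central : SSHat := (0, 1)

lemma single_coeff_ne_zero {k l : ℤ} {i j a b : Fin 2} {f : ℂ[T;T⁻¹]}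
    (h : (Finsupp.single k (Matrix.single i j f) : SS) l a b ≠ 0) : k = l ∧ i = a ∧ j = b := by
  by_cases hk : k = l
  · subst hk
    rw [Finsupp.single_eq_same, Matrix.single_apply] at h
    exact ⟨rfl, (ite_ne_right_iff.1 h).1⟩
  · rw [Finsupp.single_eq_of_ne (Ne.symm hk)] at h
    exact absurd rfl h

lemma mon_mem_piece (k : ℤ) (i j : Fin 2) (f : ℂ[T;T⁻¹]) : mon k i j f ∈ piece (deg k i j) := by
  refine ⟨fun l a b h => ?_, fun h => absurd rfl h⟩
  obtain ⟨rfl, rfl, rfl⟩ := single_coeff_ne_zero h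
  rfl

lemma mon_mem_parityPiece (k : ℤ) (i j : Fin 2) (f : ℂ[T;T⁻¹]) :
    mon k i j f ∈ parityPiece (parity i j) := by
  refine ⟨fun l a b h => ?_, fun h => absurd rfl h⟩
  obtain ⟨rfl, rfl, rfl⟩ := single_coeff_ne_zero h
  rfl

lemma central_mem_parityPiece : central ∈ parityPiece 0 := by simp [central, parityPiece]

lemma eq_sum_mon (A : SSHat) :
    A = (∑ k ∈ A.1.support, ∑ i, ∑ j, mon k i j (A.1 k i j)) + A.2 • central := by
  have h : ∀ k, ∑ i, ∑ j, mon k i j (A.1 k i j) =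
      LinearMap.inl ℂ SS ℂ (Finsupp.single k (A.1 k)) := by
    intro k
    nth_rewrite 2 [Matrix.matrix_eq_sum_single (A.1 k)]
    rw [← Finsupp.lsingle_apply (R := ℂ)]
    simp only [map_sum]
    rfl
  simp only [h]
  rw [← map_sum]
  have h2 : ∑ k ∈ A.1.support, Finsupp.single k (A.1 k) = A.1 := A.1.sum_single
  rw [h2]
  ext1 <;> simp [central]

lemma piece_induction {n : ℤ} {p : SSHat → Prop} (zero : p 0)
    (add : ∀ A B, p A → p B → p (A + B)) (mon : ∀ k i j f, deg k i j = n → p (mon k i j f))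
    (central : ∀ c : ℂ, n = 0 → p (c • central)) {A : SSHat} (hA : A ∈ piece n) : p A := by
  rw [eq_sum_mon A]
  have hsum : ∀ {ι : Type} (s : Finset ι) (g : ι → SSHat), (∀ i ∈ s, p (g i)) → p (∑ i ∈ s, g i) :=
    fun s g h => Finset.sum_induction g p add zero h
  refine add _ _ (hsum _ _ fun k _ => hsum _ _ fun i _ => hsum _ _ fun j _ => ?_) ?_
  · by_cases h : A.1 k i j = 0
    · rw [h, map_zero]
      exact zero
    · exact mon _ _ _ _ (hA.1 k i j h)
  · by_cases h : A.2 = 0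
    · rw [h, zero_smul]
      exact zero
    · exact central _ (hA.2 h)

lemma parityPart_single (α : ZMod 2) (i j : Fin 2) (f : ℂ[T;T⁻¹]) :
    parityPart α (Matrix.single i j f)
      = if α = parity i j then Matrix.single i j f else 0 := by
  ext1 a b
  rw [parityPart, Matrix.of_apply]
  by_cases h : i = a ∧ j = b
  · obtain ⟨rfl, rfl⟩ := h
    by_cases h' : parity i j = α
    · rw [if_pos h', if_pos h'.symm]
    · rw [if_neg h', if_neg (Ne.symm h'), Matrix.zero_apply]
  · have h0 : Matrix.single i j f a b = 0 := by rw [Matrix.single_apply, if_neg h]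
    split_ifs <;> simp [h0]

lemma sigma_single {q : ℂ} (hq : q ≠ 0) (k : ℤ) (i j : Fin 2) (f : ℂ[T;T⁻¹]) :
    sigma q k (Matrix.single i j f) = Matrix.single i j (dilateHom hq k f) := by
  have : dilate q k = dilateHom hq k := funext (dilate_eq_dilateHom hq k)
  rw [sigma, this, Matrix.map_single]

lemma sigma_zero {q : ℂ} (hq : q ≠ 0) (k : ℤ) : sigma q k 0 = 0 := by
  have := sigma_single hq k 0 0 0
  rwa [map_zero, Matrix.single_zero] at this

lemma single_mul_single_ite (i j a b : Fin 2) (f g : ℂ[T;T⁻¹]) :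
    Matrix.single i j f * Matrix.single a b g
      = if j = a then Matrix.single i b (f * g) else 0 := by
  split_ifs with h
  · subst h
    rw [Matrix.single_mul_single_same]
  · exact Matrix.single_mul_single_of_ne _ _ _ _ h _

lemma superComm_single {q : ℂ} (hq : q ≠ 0) (r s : ℤ) (i j a b : Fin 2) (f g : ℂ[T;T⁻¹]) :
    superComm q r s (Matrix.single i j f) (Matrix.single a b g)
      = (if j = a then Matrix.single i b (dilateHom hq s f * g) else 0)
        - sgn (parity i j) (parity a b) •
          (if b = i then Matrix.single a j (dilateHom hq r g * f) else 0) := by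
  rw [superComm, Finset.sum_eq_single (parity i j), Finset.sum_eq_single (parity a b)]
  · simp only [parityPart_single, if_true, sigma_single hq, single_mul_single_ite]
  · intro β _ hβ
    simp [parityPart_single, hβ, sigma_zero hq]
  · simp
  · intro α _ hα
    simp [parityPart_single, hα, sigma_zero hq]
  · simp

@[simp]
lemma psi_zero_zero (q : ℂ) (F G : SMat) : psi q 0 0 F G = 0 := by simp [psi]

lemma psi_of_add_ne_zero (q : ℂ) {r s : ℤ} (h : r + s ≠ 0) (F G : SMat) : psi q r s F G = 0 := by
  have : r ≠ -s := fun h' => h (by rw [h', neg_add_cancel])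
  simp [psi, this]

/-- The only nonzero value of the cocycle whose exact form matters. The minus sign arises because
`M₂₁ M₁₂ = M₂₂` lies in the negative block of the supertrace. -/
lemma psi_one_neg_one {q : ℂ} (hq : q ≠ 0) (f g : ℂ[T;T⁻¹]) :
    psi q 1 (-1) (Matrix.single 1 0 f) (Matrix.single 0 1 g)
      = -(dilateHom hq (-1) f * g).coeff 0 := by
  have h : (1 : ℤ).toNat = 1 := rfl
  simp [psi, psiPos, h, sigma_single hq, str0]

lemma psi_zero_left {q : ℂ} (hq : q ≠ 0) (r s : ℤ) (G : SMat) : psi q r s 0 G = 0 := by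
  have h : ∀ α, parityPart α 0 = 0 := fun α => by ext1; simp [parityPart]
  have h2 : ∀ k, sigma q k 0 = 0 := sigma_zero hq
  simp [psi, psiPos, h, h2, str0]

lemma psi_zero_right {q : ℂ} (hq : q ≠ 0) (r s : ℤ) (F : SMat) : psi q r s F 0 = 0 := by
  have h : ∀ α, parityPart α 0 = 0 := fun α => by ext1; simp [parityPart]
  have h2 : ∀ k, sigma q k 0 = 0 := sigma_zero hq
  simp [psi, psiPos, h, h2, str0]

lemma superComm_zero_left {q : ℂ} (hq : q ≠ 0) (r s : ℤ) (G : SMat) :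
    superComm q r s 0 G = 0 := by
  have h : ∀ α, parityPart α 0 = 0 := fun α => by ext1; simp [parityPart]
  have h2 : ∀ k, sigma q k 0 = 0 := sigma_zero hq
  simp [superComm, h, h2]

lemma superComm_zero_right {q : ℂ} (hq : q ≠ 0) (r s : ℤ) (F : SMat) :
    superComm q r s F 0 = 0 := by
  have h : ∀ α, parityPart α 0 = 0 := fun α => by ext1; simp [parityPart]
  have h2 : ∀ k, sigma q k 0 = 0 := sigma_zero hq
  simp [superComm, h, h2]

lemma bracket_mon {q : ℂ} (hq : q ≠ 0) (k s : ℤ) (i j a b : Fin 2) (f g : ℂ[T;T⁻¹]) :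
    bracket q (mon k i j f) (mon s a b g)
      = (if j = a then mon (k + s) i b (dilateHom hq s f * g) else 0)
        - sgn (parity i j) (parity a b) •
          (if b = i then mon (k + s) a j (dilateHom hq k g * f) else 0)
        + psi q k s (Matrix.single i j f) (Matrix.single a b g) • central := by
  have e : bracket q (mon k i j f) (mon s a b g)
      = LinearMap.inl ℂ SS ℂ (Finsupp.lsingle (R := ℂ) (k + s)
          (superComm q k s (Matrix.single i j f) (Matrix.single a b g)))
        + psi q k s (Matrix.single i j f) (Matrix.single a b g) • central := by
    rw [bracket, mon_apply, mon_apply, Finsupp.sum_single_index, Finsupp.sum_single_index,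
      Finsupp.sum_single_index, Finsupp.sum_single_index]
    · ext1 <;> simp [central]
    · exact psi_zero_right hq _ _ _
    · simp [psi_zero_left hq]
    · simp [superComm_zero_right hq]
    · simp [superComm_zero_left hq]
  rw [e, superComm_single hq, map_sub, map_sub, map_smul, map_smul]
  congr 3
  · split_ifs
    · rfl
    · simp
  · split_ifs
    · rfl
    · simp

lemma bracket_central (q : ℂ) (B : SSHat) : bracket q central B = 0 := by
  rw [bracket, central, Finsupp.sum_zero_index, Finsupp.sum_zero_index]
  rfl

/-! ### Modules over the central extension -/

section Modules

variable {V : Type*} [AddCommGroup V] [Module ℂ V] {q : ℂ} {lam : Module.Dual ℂ (piece 0)}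
  {ρ : SSHat →ₗ[ℂ] Module.End ℂ V} {𝒱 : ℤ → Submodule ℂ V}

/-- `v` is a highest weight vector generating the module. -/
structure IsHighestWeightVector (lam : Module.Dual ℂ (piece 0)) (ρ : SSHat →ₗ[ℂ] Module.End ℂ V)
    (𝒱 : ℤ → Submodule ℂ V) (v : V) : Prop where
  ne_zero : v ≠ 0
  span_eq : 𝒱 0 = Submodule.span ℂ {v}
  weight : ∀ h : piece 0, ρ h v = lam h • v
  generates : ∀ w : V, ∃ u ∈ Algebra.adjoin ℂ
    {φ : Module.End ℂ V | ∃ n < 0, ∃ A ∈ piece n, φ = ρ A}, u v = w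

lemma IsHighestWeightModule.exists_isHighestWeightVector (h : IsHighestWeightModule q lam ρ 𝒱) :
    ∃ v, IsHighestWeightVector lam ρ 𝒱 v := by
  -- Annihilation by positive degrees is dropped; `piece_eq_bot` recovers it.
  obtain ⟨v, h0, h1, h2, -, h3⟩ := h.exists_vector
  exact ⟨v, h0, h1, h2, h3⟩

lemma stable_of_mon {M : Submodule ℂ V}
    (hmon : ∀ k i j f, ∀ x ∈ M, ρ (mon k i j f) x ∈ M) (hC : ∀ x ∈ M, ρ central x ∈ M) (A : SSHat) :
    ∀ x ∈ M, ρ A x ∈ M := by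
  intro x hx
  rw [eq_sum_mon A]
  simp only [map_add, map_sum, map_smul, LinearMap.add_apply, LinearMap.sum_apply,
    LinearMap.smul_apply]
  exact M.add_mem (M.sum_mem fun k _ => M.sum_mem fun i _ => M.sum_mem fun j _ => hmon _ _ _ _ _ hx)
    (M.smul_mem _ (hC x hx))

namespace IsHighestWeightVector

variable {v : V}

lemma mem (hv : IsHighestWeightVector lam ρ 𝒱 v) : v ∈ 𝒱 0 := by
  rw [hv.span_eq]
  exact Submodule.mem_span_singleton_self v

/-- A submodule containing `v` and stable under the monomials of negative degree is everything. -/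
lemma mem_of_stable (hv : IsHighestWeightVector lam ρ 𝒱 v)
    (M : Submodule ℂ V) (hM : v ∈ M)
    (hstab : ∀ k i j f, deg k i j < 0 → ∀ x ∈ M, ρ (mon k i j f) x ∈ M) (x : V) : x ∈ M := by
  obtain ⟨u, hu, rfl⟩ := hv.generates x
  suffices ∀ y ∈ M, u y ∈ M from this v hM
  induction hu using Algebra.adjoin_induction with
  | mem φ hφ =>
    obtain ⟨n, hn, A, hA, rfl⟩ := hφ
    refine piece_induction (p := fun A => ∀ y ∈ M, ρ A y ∈ M) ?_ ?_ ?_ ?_ hA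
    · intro y _
      simp
    · intro A B hA hB y hy
      rw [map_add]
      exact M.add_mem (hA y hy) (hB y hy)
    · intro k i j f h
      exact hstab k i j f (h ▸ hn)
    · intro c h
      exact absurd h hn.ne
  | algebraMap c => exact fun y hy => M.smul_mem c hy
  | add a b _ _ ha hb => exact fun y hy => M.add_mem (ha y hy) (hb y hy)
  | mul a b _ _ ha hb => exact fun y hy => ha _ (hb y hy)

end IsHighestWeightVector

lemma IsGradedModule.mon_apply_mem (h : IsGradedModule q ρ 𝒱) {k : ℤ} {i j : Fin 2}
    (f : ℂ[T;T⁻¹]) {m n : ℤ} (hn : deg k i j + m = n) {x : V} (hx : x ∈ 𝒱 m) :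
    ρ (mon k i j f) x ∈ 𝒱 n :=
  hn ▸ h.map_piece _ _ _ (mon_mem_piece k i j f) x hx

lemma IsGradedModule.eq_zero_of_mem_of_mem_iSup (h : IsGradedModule q ρ 𝒱) {n : ℤ} {x : V}
    (hx : x ∈ 𝒱 n) (hx' : x ∈ ⨆ m ≠ n, 𝒱 m) : x = 0 := by
  have := h.isInternal.submodule_iSupIndep n
  exact Submodule.disjoint_def.1 this x hx hx'

/-- Commuting a monomial past another one in a module. -/
lemma IsGradedModule.mon_mon_apply (h : IsGradedModule q ρ 𝒱) (hq : q ≠ 0) (k s : ℤ)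
    (i j a b : Fin 2) (f g : ℂ[T;T⁻¹]) (x : V) :
    ρ (mon k i j f) (ρ (mon s a b g) x)
      = sgn (parity i j) (parity a b) • ρ (mon s a b g) (ρ (mon k i j f) x)
        + (if j = a then ρ (mon (k + s) i b (dilateHom hq s f * g)) x else 0)
        - sgn (parity i j) (parity a b) •
          (if b = i then ρ (mon (k + s) a j (dilateHom hq k g * f)) x else 0)
        + psi q k s (Matrix.single i j f) (Matrix.single a b g) • ρ central x := by
  have e := h.map_bracket _ _ _ (mon_mem_parityPiece k i j f) _ (mon_mem_parityPiece s a b g)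
  have e' := LinearMap.congr_fun e x
  rw [bracket_mon hq] at e'
  simp only [map_add, map_sub, map_smul, LinearMap.add_apply, LinearMap.sub_apply,
    LinearMap.smul_apply, Module.End.mul_apply] at e'
  rw [eq_sub_iff_add_eq] at e'
  rw [← e']
  have h1 : ∀ (p : Prop) [Decidable p] (A : SSHat), ρ (if p then A else 0) x
      = if p then ρ A x else 0 := by
    intro p _ A
    split_ifs <;> simp
  rw [h1, h1]
  abel

namespace IsHighestWeightVector

variable {v : V}

/-- `C` commutes with all monomials, so the eigenspace containing `v` is stable and hence
everything. -/
lemma central_apply (hv : IsHighestWeightVector lam ρ 𝒱 v)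
    (h : IsGradedModule q ρ 𝒱) (x : V) :
    ρ central x = centralCharge lam • x := by
  have : x ∈ LinearMap.ker (ρ central - centralCharge lam • (1 : Module.End ℂ V)) := by
    refine hv.mem_of_stable _ ?_ ?_ x
    · rw [LinearMap.mem_ker, LinearMap.sub_apply, sub_eq_zero]
      exact hv.weight centralElt
    · intro k i j f _ y hy
      rw [LinearMap.mem_ker, LinearMap.sub_apply, LinearMap.smul_apply, Module.End.one_apply,
        sub_eq_zero] at hy ⊢
      have e := h.map_bracket _ _ _ central_mem_parityPiece _ (mon_mem_parityPiece k i j f)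
      have hs : sgn 0 (parity i j) = 1 := by simp [sgn]
      rw [bracket_central, map_zero, hs, one_smul, eq_comm, sub_eq_zero] at e
      have e' := LinearMap.congr_fun e y
      rw [Module.End.mul_apply, Module.End.mul_apply, hy, map_smul] at e'
      exact e'
  rwa [LinearMap.mem_ker, LinearMap.sub_apply, sub_eq_zero] at this

/-- The spanning set `{v}` in degree `0`, and the images of monomials of negative degree. -/
lemma piece_eq_span (hv : IsHighestWeightVector lam ρ 𝒱 v)
    (h : IsGradedModule q ρ 𝒱) (n : ℤ) :
    𝒱 n = Submodule.span ℂ {y | (n = 0 ∧ y = v) ∨ ∃ k i j f, ∃ x ∈ 𝒱 (n - deg k i j),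
      deg k i j < 0 ∧ n ≤ deg k i j ∧ y = ρ (mon k i j f) x} := by
  set R : ℤ → Submodule ℂ V := fun n => Submodule.span ℂ {y | (n = 0 ∧ y = v) ∨
    ∃ k i j f, ∃ x ∈ 𝒱 (n - deg k i j), deg k i j < 0 ∧ n ≤ deg k i j ∧ y = ρ (mon k i j f) x}
    with hR
  have hle : ∀ n, R n ≤ 𝒱 n := by
    intro n
    refine Submodule.span_le.2 ?_
    rintro _ (⟨rfl, rfl⟩ | ⟨k, i, j, f, x, hx, -, -, rfl⟩)
    · exact hv.mem
    · exact h.mon_apply_mem f (by ring) hx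
  have hpos : ∀ n, 0 < n → R n = ⊥ := by
    intro n hn
    rw [hR, Submodule.span_eq_bot]
    rintro _ (⟨rfl, rfl⟩ | ⟨k, i, j, f, x, hx, h1, h2, rfl⟩)
    · exact absurd hn (lt_irrefl _)
    · omega
  have htop : ∀ x, x ∈ ⨆ n, R n := by
    refine hv.mem_of_stable _ ?_ ?_
    · exact Submodule.mem_iSup_of_mem 0 (Submodule.subset_span (Or.inl ⟨rfl, rfl⟩))
    · intro k i j f hd x hx
      induction hx using Submodule.iSup_induction' with
      | mem n x hx =>
        rcases lt_or_ge 0 n with hn | hn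
        · rw [hpos n hn, Submodule.mem_bot] at hx
          rw [hx, map_zero]
          exact Submodule.zero_mem _
        · refine Submodule.mem_iSup_of_mem (n + deg k i j) (Submodule.subset_span (Or.inr
            ⟨k, i, j, f, x, ?_, hd, by omega, rfl⟩))
          rw [add_sub_cancel_right]
          exact hle n hx
      | zero => rw [map_zero]; exact Submodule.zero_mem _
      | add x y _ _ hx hy => rw [map_add]; exact Submodule.add_mem _ hx hy
  refine le_antisymm (fun x hx => ?_) (hle n)
  -- The `R m` span `V` and the sum of the `𝒱 m` is direct, so the part of `x` outside `R n`
  -- vanishes.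
  have hx' : x ∈ R n ⊔ ⨆ m ≠ n, R m := by
    refine (iSup_le fun m => ?_ : ⨆ m, R m ≤ _) (htop x)
    by_cases hm : m = n
    · exact hm ▸ le_sup_left
    · exact le_sup_of_le_right (le_iSup₂_of_le m hm le_rfl)
  obtain ⟨y, hy, z, hz, rfl⟩ := Submodule.mem_sup.1 hx'
  have hz0 : z = 0 := by
    refine h.eq_zero_of_mem_of_mem_iSup (n := n) ?_ ?_
    · simpa using (𝒱 n).sub_mem hx (hle n hy)
    · exact iSup₂_mono (fun m _ => hle m) hz
  rw [hz0, add_zero]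
  exact hy

lemma piece_eq_bot (hv : IsHighestWeightVector lam ρ 𝒱 v)
    (h : IsGradedModule q ρ 𝒱) {n : ℤ} (hn : 0 < n) : 𝒱 n = ⊥ := by
  rw [hv.piece_eq_span h, Submodule.span_eq_bot]
  rintro _ (⟨rfl, rfl⟩ | ⟨k, i, j, f, x, hx, h1, h2, rfl⟩)
  · exact absurd hn (lt_irrefl _)
  · omega

end IsHighestWeightVector

/-- The elements obtained from `x` by applying monomials of nonpositive degree, with their degrees. -/
inductive Descendant (ρ : SSHat →ₗ[ℂ] Module.End ℂ V) (n : ℤ) (x : V) : ℤ → V → Prop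
  | base : Descendant ρ n x n x
  | step {m y} (k : ℤ) (i j : Fin 2) (f : ℂ[T;T⁻¹]) : Descendant ρ n x m y → deg k i j ≤ 0 →
      Descendant ρ n x (deg k i j + m) (ρ (mon k i j f) y)

/-- A vector of negative degree in `L(λ)` killed by all elements of positive degree vanishes. -/
lemma IsIrreducibleHighestWeightModule.eq_zero_of_singular
    (h : IsIrreducibleHighestWeightModule q lam ρ 𝒱) (hq : q ≠ 0) {n : ℤ} (hn : n < 0) {x : V}
    (hx : x ∈ 𝒱 n) (hsing : ∀ k i j f, 0 < deg k i j → ρ (mon k i j f) x = 0) : x = 0 := by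
  obtain ⟨v, hv⟩ := h.exists_isHighestWeightVector
  have hg := h.toIsGradedModule
  set W : Submodule ℂ V := Submodule.span ℂ {y | ∃ m, Descendant ρ n x m y} with hW
  have hdeg : ∀ m y, Descendant ρ n x m y → m ≤ n ∧ y ∈ 𝒱 m := by
    intro m y hy
    induction hy with
    | base => exact ⟨le_rfl, hx⟩
    | step k i j f _ hd ih => exact ⟨by omega, hg.mon_apply_mem f rfl ih.2⟩
  have hneg : ∀ k i j f, deg k i j ≤ 0 → ∀ y ∈ W, ρ (mon k i j f) y ∈ W := by
    intro k i j f hd y hy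
    change y ∈ W.comap (ρ (mon k i j f))
    refine Submodule.span_le.2 ?_ hy
    rintro z ⟨m, hz⟩
    exact Submodule.subset_span ⟨_, hz.step k i j f hd⟩
  -- Commuting a monomial past the last one applied leaves monomials acting on a shorter descendant.
  -- Their degree is arbitrary, so the induction is over all `k i j f` at once.
  have hpos : ∀ m y, Descendant ρ n x m y → ∀ k i j f, ρ (mon k i j f) y ∈ W := by
    intro m y hy
    induction hy with
    | base =>
      intro k i j f
      rcases lt_or_ge 0 (deg k i j) with hd | hd
      · rw [hsing k i j f hd]
        exact W.zero_mem
      · exact hneg k i j f hd _ (Submodule.subset_span ⟨_, .base⟩)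
    | @step m y s a b g hy hd ih =>
      intro k i j f
      rw [hg.mon_mon_apply hq, hv.central_apply hg]
      refine W.add_mem (W.sub_mem (W.add_mem (W.smul_mem _ (hneg _ _ _ _ hd _ (ih _ _ _ _))) ?_)
        (W.smul_mem _ ?_)) (W.smul_mem _ (W.smul_mem _ (Submodule.subset_span ⟨_, hy⟩)))
      · split_ifs
        · exact ih _ _ _ _
        · exact W.zero_mem
      · split_ifs
        · exact ih _ _ _ _
        · exact W.zero_mem
  have hstab : ∀ A, ∀ y ∈ W, ρ A y ∈ W := by
    refine stable_of_mon (fun k i j f y hy => ?_) fun y hy => ?_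
    · change y ∈ W.comap (ρ (mon k i j f))
      refine Submodule.span_le.2 ?_ hy
      rintro z ⟨m, hz⟩
      exact hpos m z hz k i j f
    · rw [hv.central_apply hg]
      exact W.smul_mem _ hy
  have hgr : W = ⨆ m, W ⊓ 𝒱 m := by
    refine le_antisymm (Submodule.span_le.2 ?_) (iSup_le fun m => inf_le_left)
    rintro y ⟨m, hy⟩
    exact Submodule.mem_iSup_of_mem m ⟨Submodule.subset_span ⟨m, hy⟩, (hdeg m y hy).2⟩
  rcases h.irreducible W hstab hgr with h0 | h1
  · have : x ∈ W := Submodule.subset_span ⟨n, .base⟩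
    rwa [h0, Submodule.mem_bot] at this
  · exfalso
    refine hv.ne_zero (hg.eq_zero_of_mem_of_mem_iSup hv.mem ?_)
    have hvW : v ∈ W := h1 ▸ Submodule.mem_top
    refine (Submodule.span_le.2 ?_ : W ≤ _) hvW
    rintro y ⟨m, hy⟩
    obtain ⟨hm, hy'⟩ := hdeg m y hy
    exact Submodule.mem_iSup_of_mem m (Submodule.mem_iSup_of_mem (by omega) hy')

end Modules

/-! ### The weight in terms of the generating series -/

section Weights

/-- The functional `f ↦ λ(f(T_q) M_{ii})`. -/
def diagWeight (lam : Module.Dual ℂ (piece 0)) (i : Fin 2) : ℂ[T;T⁻¹] →ₗ[ℂ] ℂ :=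
  lam ∘ₗ (mon 0 i i).codRestrict (piece 0) fun f => by
    have := mon_mem_piece 0 i i f
    rwa [show deg 0 i i = 0 by simp [deg]] at this

lemma diagWeight_T (lam : Module.Dual ℂ (piece 0)) (i : Fin 2) (l : ℤ) :
    diagWeight lam i (LaurentPolynomial.T l) = -label lam l i := by
  rw [label, neg_neg]
  rfl

/-- The functional giving the pairing of `f(T_q) M_{12}` with `g(T_q) M_{21}` on a highest weight
vector. -/
def pairing₂₁ (lam : Module.Dual ℂ (piece 0)) : ℂ[T;T⁻¹] →ₗ[ℂ] ℂ :=
  diagWeight lam 0 + diagWeight lam 1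

/-- The constant coefficient. -/
def constCoeff : ℂ[T;T⁻¹] →ₗ[ℂ] ℂ where
  toFun f := f.coeff 0
  map_add' _ _ := rfl
  map_smul' _ _ := rfl

lemma constCoeff_apply (f : ℂ[T;T⁻¹]) : constCoeff f = f.coeff 0 := rfl

/-- The functional giving the pairing of `z f(T_q) M_{21}` with `z⁻¹ g(T_q) M_{12}` on a highest weight
vector. -/
def pairing₁₂ {q : ℂ} (hq : q ≠ 0) (lam : Module.Dual ℂ (piece 0)) : ℂ[T;T⁻¹] →ₗ[ℂ] ℂ :=
  diagWeight lam 0 ∘ₗ (dilateHom hq 1).toLinearMap + diagWeight lam 1 - centralCharge lam • constCoeff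

lemma pairing₂₁_T (lam : Module.Dual ℂ (piece 0)) (n : ℤ) :
    pairing₂₁ lam (LaurentPolynomial.T n) = -(genSeries lam 0 + genSeries lam 1) (-n) := by
  simp only [pairing₂₁, LinearMap.add_apply, diagWeight_T, Pi.add_apply, genSeries, neg_neg]
  ring

lemma pairing₁₂_T {q : ℂ} (hq : q ≠ 0) (lam : Module.Dual ℂ (piece 0)) (n : ℤ) :
    pairing₁₂ hq lam (LaurentPolynomial.T n) = -(rescale q⁻¹ (genSeries lam 0) + genSeries lam 1
      + constSeries (centralCharge lam)) (-n) := by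
  simp only [pairing₁₂, LinearMap.add_apply, LinearMap.sub_apply, LinearMap.smul_apply,
    LinearMap.comp_apply, AlgHom.toLinearMap_apply, dilateHom_T, map_smul, diagWeight_T, Pi.add_apply,
    genSeries, neg_neg, rescale, constSeries, inv_zpow', one_mul, smul_eq_mul, neg_eq_zero,
    constCoeff_apply, LaurentPolynomial.T_apply]
  split_ifs <;> ring

/-- On `T^n b` the functional takes, up to sign, a coefficient of the product series, and the `T^n
b` span the ideal of `b`. -/
lemma polyMul_eq_zero_iff_forall_mul {φ : ℂ[T;T⁻¹] →ₗ[ℂ] ℂ} {a : BiSeries}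
    (h : ∀ n, φ (LaurentPolynomial.T n) = -a (-n)) (b : ℂ[X]) :
    polyMul b a = 0 ↔ ∀ f, φ (f * Polynomial.toLaurent b) = 0 := by
  have key : ∀ n, φ (LaurentPolynomial.T n * Polynomial.toLaurent b) = -polyMul b a (-n) := by
    intro n
    have hb : Polynomial.toLaurent b
        = ∑ k ∈ b.support, b.coeff k • (LaurentPolynomial.T (k : ℤ) : ℂ[T;T⁻¹]) := by
      nth_rewrite 1 [b.as_sum_support_C_mul_X_pow]
      rw [map_sum]
      refine Finset.sum_congr rfl fun k _ => ?_
      rw [Polynomial.toLaurent_C_mul_X_pow, LaurentPolynomial.smul_eq_C_mul]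
    rw [hb, Finset.mul_sum, map_sum, polyMul, Polynomial.sum, ← Finset.sum_neg_distrib]
    refine Finset.sum_congr rfl fun k _ => ?_
    rw [mul_smul_comm, map_smul, ← LaurentPolynomial.T_add, h, smul_eq_mul, mul_neg]
    congr 3
    ring
  constructor
  · intro h0 f
    have : φ ∘ₗ LinearMap.mulRight ℂ (Polynomial.toLaurent b) = 0 := by
      refine laurent_linearMap_ext fun n => ?_
      rw [LinearMap.comp_apply, LinearMap.mulRight_apply, key, h0]
      simp
    exact LinearMap.congr_fun this f
  · intro h0
    ext n
    have := key (-n)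
    rw [h0, neg_neg, eq_comm, neg_eq_zero] at this
    exact this

end Weights

/-! ### Necessity: the pairing between degrees `1/2` and `-1/2` -/

section Modules

variable {V : Type*} [AddCommGroup V] [Module ℂ V] {q : ℂ} {lam : Module.Dual ℂ (piece 0)}
  {ρ : SSHat →ₗ[ℂ] Module.End ℂ V} {𝒱 : ℤ → Submodule ℂ V}

namespace IsHighestWeightVector

variable {v : V}

lemma mon_diag_apply (hv : IsHighestWeightVector lam ρ 𝒱 v)
    (i : Fin 2) (f : ℂ[T;T⁻¹]) : ρ (mon 0 i i f) v = diagWeight lam i f • v :=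
  hv.weight ⟨mon 0 i i f, _⟩

lemma mon_apply_eq_zero (hv : IsHighestWeightVector lam ρ 𝒱 v)
    (h : IsGradedModule q ρ 𝒱) {k : ℤ} {i j : Fin 2} (f : ℂ[T;T⁻¹])
    {n : ℤ} {x : V} (hx : x ∈ 𝒱 n) (hd : 0 < deg k i j + n) : ρ (mon k i j f) x = 0 := by
  have := h.mon_apply_mem (k := k) (i := i) (j := j) f rfl hx
  rwa [hv.piece_eq_bot h hd, Submodule.mem_bot] at this

/-- The positive factor kills `v`, so only the bracket acts. Both elements are odd, so it is an
anticommutator, whence the sum of the two diagonal weights. -/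
lemma mon₁₂_mon₂₁_apply (hv : IsHighestWeightVector lam ρ 𝒱 v)
    (h : IsGradedModule q ρ 𝒱) (hq : q ≠ 0) (f g : ℂ[T;T⁻¹]) :
    ρ (mon 0 0 1 f) (ρ (mon 0 1 0 g) v) = pairing₂₁ lam (f * g) • v := by
  rw [h.mon_mon_apply hq, hv.mon_apply_eq_zero h f hv.mem (by simp [deg]), if_pos rfl, if_pos rfl]
  simp only [add_zero, dilateHom_zero, psi_zero_zero, zero_smul, map_zero, smul_zero, zero_add]
  rw [hv.mon_diag_apply, hv.mon_diag_apply, pairing₂₁, LinearMap.add_apply, mul_comm g f]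
  simp [sgn, parity, add_smul]

/-- With `h = f(q⁻¹T) g`, the bracket has `M₂₂` entry `h(T)`, `M₁₁` entry `h(qT)` and central term
minus the constant coefficient of `h`; the scalar therefore depends on `h` alone. -/
lemma mon₂₁_mon₁₂_apply (hv : IsHighestWeightVector lam ρ 𝒱 v)
    (h : IsGradedModule q ρ 𝒱) (hq : q ≠ 0) (f g : ℂ[T;T⁻¹]) :
    ρ (mon 1 1 0 f) (ρ (mon (-1) 0 1 g) v) = pairing₁₂ hq lam (dilateHom hq (-1) f * g) • v := by
  rw [h.mon_mon_apply hq, hv.mon_apply_eq_zero h f hv.mem (by simp [deg]), if_pos rfl, if_pos rfl,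
    psi_one_neg_one hq, hv.central_apply h]
  simp only [add_neg_cancel, map_zero, smul_zero, zero_add]
  rw [hv.mon_diag_apply, hv.mon_diag_apply]
  simp only [pairing₁₂, LinearMap.add_apply, LinearMap.sub_apply, LinearMap.smul_apply,
    LinearMap.comp_apply, AlgHom.toLinearMap_apply, map_mul, dilateHom_dilateHom,
    add_neg_cancel, dilateHom_zero]
  have hs : sgn (parity 1 0) (parity 0 1) = -1 := by simp [sgn, parity]
  rw [hs, mul_comm f, constCoeff_apply, smul_eq_mul]
  module

end IsHighestWeightVector

/-- `ℂ[X]` is infinite-dimensional, so its image in `U` cannot be a faithful copy. -/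
lemma exists_monic_of_finiteDimensional {U : Submodule ℂ V} [FiniteDimensional ℂ U]
    (φ : ℂ[T;T⁻¹] →ₗ[ℂ] V) (hφ : ∀ f, φ f ∈ U) :
    ∃ b : ℂ[X], b.Monic ∧ φ (Polynomial.toLaurent b) = 0 := by
  let θ : ℂ[X] →ₗ[ℂ] U := (φ.codRestrict U hφ) ∘ₗ Polynomial.toLaurentAlg.toLinearMap
  have hθ : ¬ Function.Injective θ := fun hinj => by
    have := FiniteDimensional.of_injective θ hinj
    exact Polynomial.not_finite (R := ℂ) this
  rw [← LinearMap.ker_eq_bot, ← ne_eq, Submodule.ne_bot_iff] at hθ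
  obtain ⟨b, hb, hb0⟩ := hθ
  have hb' : φ (Polynomial.toLaurent b) = 0 := congrArg Subtype.val (LinearMap.mem_ker.1 hb)
  refine ⟨b * Polynomial.C b.leadingCoeff⁻¹, Polynomial.monic_mul_leadingCoeff_inv hb0, ?_⟩
  rw [mul_comm, Polynomial.toLaurent_C_mul_eq, ← LaurentPolynomial.smul_eq_C_mul, map_smul, hb',
    smul_zero]

lemma IsHighestWeightModule.exists_polyMul_eq_zero (h : IsHighestWeightModule q lam ρ 𝒱)
    (hq : q ≠ 0) (hfin : IsQuasifinite 𝒱) :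
    ∃ b₁₂ b₂₁ : Polynomial ℂ, b₁₂.Monic ∧ b₂₁.Monic ∧
      polyMul b₁₂ (rescale q⁻¹ (genSeries lam 0) + genSeries lam 1
        + constSeries (centralCharge lam)) = 0 ∧
      polyMul b₂₁ (genSeries lam 0 + genSeries lam 1) = 0 := by
  obtain ⟨v, hv⟩ := h.exists_isHighestWeightVector
  have hg := h.toIsGradedModule
  have := hfin (-1)
  obtain ⟨b₁, hb₁, e₁⟩ := exists_monic_of_finiteDimensional (U := 𝒱 (-1))
    (LinearMap.applyₗ v ∘ₗ ρ ∘ₗ mon (-1) 0 1)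
    (fun f => hg.mon_apply_mem f (by simp [deg]) hv.mem)
  obtain ⟨b₂, hb₂, e₂⟩ := exists_monic_of_finiteDimensional (U := 𝒱 (-1))
    (LinearMap.applyₗ v ∘ₗ ρ ∘ₗ mon 0 1 0) (fun f => hg.mon_apply_mem f (by simp [deg]) hv.mem)
  simp only [LinearMap.comp_apply, LinearMap.applyₗ_apply_apply] at e₁ e₂
  refine ⟨b₁, b₂, hb₁, hb₂, ?_, ?_⟩
  · rw [polyMul_eq_zero_iff_forall_mul (pairing₁₂_T hq lam)]
    intro f
    have := hv.mon₂₁_mon₁₂_apply hg hq (dilateHom hq 1 f) (Polynomial.toLaurent b₁)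
    rw [e₁, map_zero, dilateHom_dilateHom, neg_add_cancel, dilateHom_zero, eq_comm,
      smul_eq_zero] at this
    exact this.resolve_right hv.ne_zero
  · rw [polyMul_eq_zero_iff_forall_mul (pairing₂₁_T lam)]
    intro f
    have := hv.mon₁₂_mon₂₁_apply hg hq f (Polynomial.toLaurent b₂)
    rw [e₂, map_zero, eq_comm, smul_eq_zero] at this
    exact this.resolve_right hv.ne_zero

/-! ### Annihilators of vectors -/

/-- The elements `z^k g(T_q) F(T_q) M_{ij}` annihilate `x`. -/
def Annihilates (ρ : SSHat →ₗ[ℂ] Module.End ℂ V) (x : V) (k : ℤ) (i j : Fin 2)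
    (F : ℂ[T;T⁻¹]) : Prop :=
  ∀ g, ρ (mon k i j (g * F)) x = 0

lemma Annihilates.mul_left {x : V} {k : ℤ} {i j : Fin 2} {F : ℂ[T;T⁻¹]}
    (h : Annihilates ρ x k i j F) (f : ℂ[T;T⁻¹]) : Annihilates ρ x k i j (f * F) := fun g => by
  rw [← mul_assoc]
  exact h _

lemma Annihilates.mul_right {x : V} {k : ℤ} {i j : Fin 2} {F : ℂ[T;T⁻¹]}
    (h : Annihilates ρ x k i j F) (f : ℂ[T;T⁻¹]) : Annihilates ρ x k i j (F * f) :=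
  mul_comm f F ▸ h.mul_left f

/-- The vectors `x` such that, for each negative degree monomial type, a nonzero ideal of coefficients
annihilates `x`. -/
def torsionVectors (ρ : SSHat →ₗ[ℂ] Module.End ℂ V) : Submodule ℂ V where
  carrier := {x | ∀ k i j, deg k i j < 0 → ∃ F, F ≠ 0 ∧ Annihilates ρ x k i j F}
  zero_mem' := fun k i j _ => ⟨1, one_ne_zero, fun g => map_zero _⟩
  add_mem' := by
    intro x y hx hy k i j hd
    obtain ⟨F, hF, hx⟩ := hx k i j hd
    obtain ⟨G, hG, hy⟩ := hy k i j hd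
    refine ⟨F * G, mul_ne_zero hF hG, fun g => ?_⟩
    rw [map_add, hx.mul_right G g, hy.mul_left F g, add_zero]
  smul_mem' := by
    intro c x hx k i j hd
    obtain ⟨F, hF, hx⟩ := hx k i j hd
    exact ⟨F, hF, fun g => by rw [map_smul, hx g, smul_zero]⟩

lemma IsGradedModule.mon_mem_torsionVectors (h : IsGradedModule q ρ 𝒱) (hq : q ≠ 0) {x : V}
    (hx : x ∈ torsionVectors ρ) {s : ℤ} {a b : Fin 2} (f : ℂ[T;T⁻¹]) (hs : deg s a b < 0) :
    ρ (mon s a b f) x ∈ torsionVectors ρ := by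
  intro k i j hk
  obtain ⟨F₁, hF₁, h₁⟩ := hx k i j hk
  have h2 : ∃ F, F ≠ 0 ∧ (j = a → Annihilates ρ x (k + s) i b F) := by
    by_cases hja : j = a
    · obtain ⟨F, hF, h'⟩ := hx (k + s) i b (by subst hja; simp only [deg] at *; omega)
      exact ⟨F, hF, fun _ => h'⟩
    · exact ⟨1, one_ne_zero, fun h => absurd h hja⟩
  have h3 : ∃ F, F ≠ 0 ∧ (b = i → Annihilates ρ x (k + s) a j F) := by
    by_cases hbi : b = i
    · obtain ⟨F, hF, h'⟩ := hx (k + s) a j (by subst hbi; simp only [deg] at *; omega)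
      exact ⟨F, hF, fun _ => h'⟩
    · exact ⟨1, one_ne_zero, fun h => absurd h hbi⟩
  obtain ⟨F₂, hF₂, h₂⟩ := h2
  obtain ⟨F₃, hF₃, h₃⟩ := h3
  -- The three factors kill the three terms left by the commutation. Moving past `z^s` dilates by
  -- `q^s`, which the dilation of `F₂` undoes.
  refine ⟨F₁ * dilateHom hq (-s) F₂ * F₃,
    mul_ne_zero (mul_ne_zero hF₁ (dilateHom_ne_zero hq _ hF₂)) hF₃, fun g => ?_⟩
  -- Two negative degrees with opposite powers of `z` force `k = s = 0`, where the cocycle vanishes.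
  have hpsi : ∀ F G, psi q k s F G = 0 := by
    intro F G
    by_cases hks : k + s = 0
    · have : k = 0 ∧ s = 0 := by simp only [deg] at *; omega
      rw [this.1, this.2, psi_zero_zero]
    · exact psi_of_add_ne_zero q hks F G
  rw [h.mon_mon_apply hq, hpsi, zero_smul, add_zero,
    (h₁.mul_right (dilateHom hq (-s) F₂)).mul_right F₃ g, map_zero, smul_zero, zero_add]
  have e₂ : dilateHom hq s (g * (F₁ * dilateHom hq (-s) F₂ * F₃)) * f
      = (dilateHom hq s (g * F₁ * F₃) * f) * F₂ := by
    simp only [map_mul, dilateHom_dilateHom, add_neg_cancel, dilateHom_zero]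
    ring
  have e₃ : dilateHom hq k f * (g * (F₁ * dilateHom hq (-s) F₂ * F₃))
      = (dilateHom hq k f * g * F₁ * dilateHom hq (-s) F₂) * F₃ := by ring
  rw [e₂, e₃]
  split_ifs with ha hb hb
  · rw [h₂ ha, h₃ hb, smul_zero, sub_zero]
  · rw [h₂ ha, smul_zero, sub_zero]
  · rw [h₃ hb, smul_zero, sub_zero]
  · rw [smul_zero, sub_zero]

end Modules

/-! ### Quasifiniteness from annihilating polynomials -/

/-- Quotients of Laurent polynomials over a field by nonzero ideals are finite-dimensional. -/
lemma finiteDimensional_laurent_quotient {F : ℂ[T;T⁻¹]} (hF : F ≠ 0) :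
    FiniteDimensional ℂ (ℂ[T;T⁻¹] ⧸ Ideal.span {F}) := by
  obtain ⟨n, p, hp⟩ := F.exists_T_pow
  have hp0 : p ≠ 0 := by
    rw [← Polynomial.toLaurent_ne_zero, hp]
    exact mul_ne_zero hF (LaurentPolynomial.isUnit_T _).ne_zero
  set π := Ideal.Quotient.mkₐ ℂ (Ideal.span {F}) with hπ
  have hπF : π F = 0 := Ideal.Quotient.eq_zero_iff_mem.2 (Ideal.mem_span_singleton_self F)
  have haeval : Polynomial.aeval (π (LaurentPolynomial.T 1)) p = 0 := by
    have h1 : Polynomial.aeval (LaurentPolynomial.T 1 : ℂ[T;T⁻¹]) p = Polynomial.toLaurent p := by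
      have : Polynomial.aeval (LaurentPolynomial.T 1 : ℂ[T;T⁻¹]) = Polynomial.toLaurentAlg := by
        ext
        simp
      rw [this]
      rfl
    rw [Polynomial.aeval_algHom_apply, h1, hp, map_mul, hπF, zero_mul]
  have hint : IsIntegral ℂ (π (LaurentPolynomial.T 1)) :=
    IsAlgebraic.isIntegral ⟨p, hp0, haeval⟩
  let _ : Invertible (π (LaurentPolynomial.T 1)) := Invertible.map π (LaurentPolynomial.T 1)
  have hinv : ⅟(π (LaurentPolynomial.T 1)) = π (LaurentPolynomial.T (-1)) := rfl
  -- The inverse of a root of `p` is a root of the reversed polynomial.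
  have hint' : IsIntegral ℂ (π (LaurentPolynomial.T (-1))) := by
    refine IsAlgebraic.isIntegral ⟨p.reverse, fun h => hp0 (Polynomial.reverse_eq_zero.1 h), ?_⟩
    rw [← hinv, Polynomial.aeval_def, Polynomial.eval₂_reverse_eq_zero_iff]
    exact haeval
  have hfg := Algebra.finite_adjoin_of_finite_of_isIntegral (R := ℂ)
    (s := {π (LaurentPolynomial.T 1), π (LaurentPolynomial.T (-1))}) (by simp)
    (by rintro x (rfl | rfl) <;> assumption)
  have hT : ∀ n : ℤ, π (LaurentPolynomial.T n) ∈ Algebra.adjoin ℂ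
      {π (LaurentPolynomial.T 1), π (LaurentPolynomial.T (-1))} := by
    intro n
    obtain ⟨m, rfl | rfl⟩ := n.eq_nat_or_neg
    · have : (LaurentPolynomial.T (m : ℤ) : ℂ[T;T⁻¹]) = LaurentPolynomial.T 1 ^ m := by simp
      rw [this, map_pow]
      exact pow_mem (Algebra.subset_adjoin (by simp)) m
    · have : (LaurentPolynomial.T (-(m : ℤ)) : ℂ[T;T⁻¹]) = LaurentPolynomial.T (-1) ^ m := by simp
      rw [this, map_pow]
      exact pow_mem (Algebra.subset_adjoin (by simp)) m
  have htop : Algebra.adjoin ℂ {π (LaurentPolynomial.T 1), π (LaurentPolynomial.T (-1))} = ⊤ := by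
    rw [eq_top_iff]
    rintro x -
    obtain ⟨f, rfl⟩ := Ideal.Quotient.mk_surjective x
    change π f ∈ _
    induction f using LaurentPolynomial.induction_on' with
    | add f g hf hg => rw [map_add]; exact add_mem hf hg
    | C_mul_T n a =>
      rw [← LaurentPolynomial.smul_eq_C_mul, map_smul]
      exact Subalgebra.smul_mem _ (hT n) a
  rw [htop] at hfg
  exact Module.Finite.equiv Subalgebra.topEquiv.toLinearEquiv

section Modules

variable {V : Type*} [AddCommGroup V] [Module ℂ V] {q : ℂ} {lam : Module.Dual ℂ (piece 0)}
  {ρ : SSHat →ₗ[ℂ] Module.End ℂ V} {𝒱 : ℤ → Submodule ℂ V}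

lemma finiteDimensional_range_of_ideal {φ : ℂ[T;T⁻¹] →ₗ[ℂ] V} {F : ℂ[T;T⁻¹]} (hF : F ≠ 0)
    (h : ∀ g, φ (g * F) = 0) : FiniteDimensional ℂ (LinearMap.range φ) := by
  have := finiteDimensional_laurent_quotient hF
  set I := (Ideal.span {F}).restrictScalars ℂ with hI
  have hle : I ≤ LinearMap.ker φ := by
    intro f hf
    obtain ⟨g, rfl⟩ := Ideal.mem_span_singleton'.1 hf
    exact h g
  have hfin : FiniteDimensional ℂ (ℂ[T;T⁻¹] ⧸ I) := this
  rw [← Submodule.range_liftQ I φ hle]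
  infer_instance

/-- Each generator of `U` has its own `F` and contributes an image of `ℂ[T;T⁻¹]/(F)`; finitely many
generators suffice. -/
lemma finiteDimensional_map₂_of_torsionVectors {k : ℤ} {i j : Fin 2} (hd : deg k i j < 0)
    {U : Submodule ℂ V} (hU : U ≤ torsionVectors ρ) (hfin : FiniteDimensional ℂ U) :
    FiniteDimensional ℂ (Submodule.map₂ (ρ ∘ₗ mon k i j) ⊤ U) := by
  refine Submodule.fg_induction (motive := fun N _ => N ≤ torsionVectors ρ →
    FiniteDimensional ℂ (Submodule.map₂ (ρ ∘ₗ mon k i j) ⊤ N)) (fun x hx => ?_)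
    (fun N₁ N₂ _ _ h₁ h₂ hN => ?_) U ((Submodule.fg_iff_finiteDimensional U).2 hfin) hU
  · obtain ⟨F, hF, h⟩ := hx (Submodule.mem_span_singleton_self x) k i j hd
    rw [Submodule.map₂_span_singleton_eq_map_flip, Submodule.map_top]
    exact finiteDimensional_range_of_ideal hF h
  · have := h₁ (le_sup_left.trans hN)
    have := h₂ (le_sup_right.trans hN)
    rw [Submodule.map₂_sup_right]
    infer_instance

lemma IsGradedModule.isQuasifinite_of_torsionVectors (h : IsGradedModule q ρ 𝒱) {v : V}
    (hv : IsHighestWeightVector lam ρ 𝒱 v) (htor : torsionVectors ρ = ⊤) : IsQuasifinite 𝒱 := by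
  suffices ∀ (N : ℕ) (n : ℤ), -(N : ℤ) ≤ n → FiniteDimensional ℂ (𝒱 n) from
    fun n => this n.natAbs n (by omega)
  intro N
  induction N with
  | zero =>
    intro n hn
    rcases eq_or_lt_of_le (show 0 ≤ n by simpa using hn) with rfl | hn'
    · rw [hv.span_eq]
      infer_instance
    · rw [hv.piece_eq_bot h hn']
      infer_instance
  | succ N ih =>
    intro n hn
    let B : ℤ × Fin 2 × Fin 2 → Submodule ℂ V := fun t =>
      if deg t.1 t.2.1 t.2.2 < 0 then
        Submodule.map₂ (ρ ∘ₗ mon t.1 t.2.1 t.2.2) ⊤ (𝒱 (n - deg t.1 t.2.1 t.2.2)) else ⊥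
    have hB : ∀ t, FiniteDimensional ℂ (B t) := by
      intro t
      by_cases hd : deg t.1 t.2.1 t.2.2 < 0
      · rw [show B t = _ from if_pos hd]
        exact finiteDimensional_map₂_of_torsionVectors hd (htor ▸ le_top)
          (ih (n - deg t.1 t.2.1 t.2.2) (by omega))
      · rw [show B t = _ from if_neg hd]
        infer_instance
    -- The inequalities `n ≤ deg k i j < 0` confine `k` to a finite range, for which `[n - 1, 0]` is
    -- a crude bound.
    have hle : 𝒱 n ≤ Submodule.span ℂ {v} ⊔ (Finset.Icc (n - 1) 0 ×ˢ Finset.univ).sup B := by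
      rw [hv.piece_eq_span h, Submodule.span_le]
      rintro _ (⟨-, rfl⟩ | ⟨k, i, j, f, x, hx, hd, hnd, rfl⟩)
      · exact Submodule.mem_sup_left (Submodule.mem_span_singleton_self _)
      · refine Submodule.mem_sup_right (Finset.le_sup (f := B) (b := (k, i, j)) ?_ ?_)
        · simp only [deg] at hd hnd
          simp only [Finset.mem_product, Finset.mem_Icc, Finset.mem_univ, and_true]
          omega
        · rw [show B (k, i, j) = _ from if_pos hd]
          exact Submodule.apply_mem_map₂ (ρ ∘ₗ mon k i j) (Submodule.mem_top (x := f)) hx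
    exact Submodule.finiteDimensional_of_le hle

/-! ### Annihilators of the highest weight vector in degree `-1/2` -/

namespace IsHighestWeightVector

variable {v : V}

lemma annihilates_of_polyMul_eq_zero (hv : IsHighestWeightVector lam ρ 𝒱 v)
    (h : IsIrreducibleHighestWeightModule q lam ρ 𝒱)
    (hq : q ≠ 0) {b₁₂ b₂₁ : ℂ[X]}
    (h₁₂ : polyMul b₁₂ (rescale q⁻¹ (genSeries lam 0) + genSeries lam 1
      + constSeries (centralCharge lam)) = 0)
    (h₂₁ : polyMul b₂₁ (genSeries lam 0 + genSeries lam 1) = 0) :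
    Annihilates ρ v (-1) 0 1 (Polynomial.toLaurent b₁₂) ∧
      Annihilates ρ v 0 1 0 (Polynomial.toLaurent b₂₁) := by
  have hg := h.toIsGradedModule
  rw [polyMul_eq_zero_iff_forall_mul (pairing₁₂_T hq lam)] at h₁₂
  rw [polyMul_eq_zero_iff_forall_mul (pairing₂₁_T lam)] at h₂₁
  have hdeg : ∀ k i j, deg k i j = 1 → (k = 0 ∧ i = 0 ∧ j = 1) ∨ (k = 1 ∧ i = 1 ∧ j = 0) := by
    intro k i j hd
    fin_cases i <;> fin_cases j <;> simp [deg] at hd ⊢ <;> omega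
  constructor
  · intro g
    have hm : ρ (mon (-1) 0 1 (g * Polynomial.toLaurent b₁₂)) v ∈ 𝒱 (-1) :=
      hg.mon_apply_mem _ (by simp [deg]) hv.mem
    refine h.eq_zero_of_singular hq (by norm_num) hm fun k i j f hd => ?_
    rcases eq_or_lt_of_le (show 1 ≤ deg k i j by omega) with hd1 | hd1
    · rcases hdeg k i j hd1.symm with ⟨rfl, rfl, rfl⟩ | ⟨rfl, rfl, rfl⟩
      -- Here `M₁₂ M₁₂ = 0` and the powers of `z` do not cancel, so the bracket vanishes.
      · rw [hg.mon_mon_apply hq, hv.mon_apply_eq_zero hg f hv.mem (by simp [deg]),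
          psi_of_add_ne_zero q (by norm_num)]
        simp
      · rw [hv.mon₂₁_mon₁₂_apply hg hq, ← mul_assoc, h₁₂, zero_smul]
    · exact hv.mon_apply_eq_zero hg f hm (by omega)
  · intro g
    have hm : ρ (mon 0 1 0 (g * Polynomial.toLaurent b₂₁)) v ∈ 𝒱 (-1) :=
      hg.mon_apply_mem _ (by simp [deg]) hv.mem
    refine h.eq_zero_of_singular hq (by norm_num) hm fun k i j f hd => ?_
    rcases eq_or_lt_of_le (show 1 ≤ deg k i j by omega) with hd1 | hd1
    · rcases hdeg k i j hd1.symm with ⟨rfl, rfl, rfl⟩ | ⟨rfl, rfl, rfl⟩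
      · rw [hv.mon₁₂_mon₂₁_apply hg hq, ← mul_assoc, h₂₁, zero_smul]
      · rw [hg.mon_mon_apply hq, hv.mon_apply_eq_zero hg f hv.mem (by simp [deg]),
          psi_of_add_ne_zero q (by norm_num)]
        simp
    · exact hv.mon_apply_eq_zero hg f hm (by omega)

end IsHighestWeightVector

/-! ### From degree `-1/2` to all negative degrees -/

/-- Brackets of annihilating monomials annihilate, for the products `M_{12} M_{21}` and
`M_{21} M_{12}`. -/
lemma IsGradedModule.annihilates_diag (h : IsGradedModule q ρ 𝒱) (hq : q ≠ 0) {x : V} {s : ℕ}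
    (hqs : q ^ (s + 1) ≠ 1) {F G : ℂ[T;T⁻¹]} (hF : Annihilates ρ x (-1) 0 1 F)
    (hG : Annihilates ρ x (-s) 1 0 G) :
    Annihilates ρ x (-(s + 1 : ℕ)) 0 0 (dilateHom hq (-s) F * G) ∧
      Annihilates ρ x (-(s + 1 : ℕ)) 1 1 (dilateHom hq (-1) G * F) := by
  have hks : (-1 + -(s : ℤ)) = -(s + 1 : ℕ) := by push_cast; ring
  -- The anticommutator kills `x` but mixes the two diagonal entries. Inserting `T^a` in one factor
  -- and `T^{-a}` in the other rescales them by different powers of `q`; comparing `a = 0` with `a =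
  -- 1` separates them unless `q = q^{-s}`.
  have key : ∀ (a : ℤ) (g : ℂ[T;T⁻¹]),
      q ^ (-(s : ℤ) * a) • ρ (mon (-(s + 1 : ℕ)) 0 0 (g * (dilateHom hq (-s) F * G))) x
        + q ^ a • ρ (mon (-(s + 1 : ℕ)) 1 1
          (dilateHom hq (-1) g * (dilateHom hq (-1) G * F))) x = 0 := by
    intro a g
    have e := h.mon_mon_apply hq (-1) (-s) 0 1 1 0 (LaurentPolynomial.T a * F)
      (LaurentPolynomial.T (-a) * g * G) x
    have hs : sgn (parity 0 1) (parity 1 0) = -1 := by simp [sgn, parity]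
    have hT : ∀ b : ℤ, (LaurentPolynomial.T b * LaurentPolynomial.T (-b) : ℂ[T;T⁻¹]) = 1 := by
      intro b
      rw [← LaurentPolynomial.T_add, add_neg_cancel, LaurentPolynomial.T_zero]
    have e1 : dilateHom hq (-s) (LaurentPolynomial.T a * F) * (LaurentPolynomial.T (-a) * g * G)
        = q ^ (-(s : ℤ) * a) • (g * (dilateHom hq (-s) F * G)) := by
      rw [map_mul, dilateHom_T, smul_mul_assoc, smul_mul_assoc]
      congr 1
      linear_combination (g * (dilateHom hq (-s) F * G)) * hT a
    have e2 : dilateHom hq (-1) (LaurentPolynomial.T (-a) * g * G) * (LaurentPolynomial.T a * F)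
        = q ^ a • (dilateHom hq (-1) g * (dilateHom hq (-1) G * F)) := by
      rw [map_mul, map_mul, dilateHom_T, smul_mul_assoc, smul_mul_assoc, smul_mul_assoc,
        neg_one_mul, neg_neg]
      congr 1
      linear_combination (dilateHom hq (-1) g * (dilateHom hq (-1) G * F)) * hT a
    rw [hF, hG, if_pos rfl, if_pos rfl, psi_of_add_ne_zero q (by omega), hs, hks, e1, e2] at e
    simp only [map_zero, smul_zero, zero_add, zero_smul, add_zero, map_smul, neg_smul, one_smul,
      sub_neg_eq_add, LinearMap.smul_apply] at e
    exact e.symm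
  have h1 : ∀ g, ρ (mon (-(s + 1 : ℕ)) 1 1
      (dilateHom hq (-1) g * (dilateHom hq (-1) G * F))) x = 0 := by
    intro g
    have k0 := key 0 g
    have k1 := key 1 g
    rw [mul_zero, zpow_zero, one_smul, one_smul] at k0
    rw [mul_one, zpow_one] at k1
    have : (q - q ^ (-(s : ℤ))) • ρ (mon (-(s + 1 : ℕ)) 1 1
        (dilateHom hq (-1) g * (dilateHom hq (-1) G * F))) x = 0 := by
      rw [eq_neg_of_add_eq_zero_left k0, smul_neg, neg_add_eq_sub, ← sub_smul] at k1
      exact k1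
    refine (smul_eq_zero.1 this).resolve_left fun h0 => hqs ?_
    rw [sub_eq_zero, zpow_neg, zpow_natCast] at h0
    rw [pow_succ]
    nth_rewrite 2 [h0]
    exact mul_inv_cancel₀ (pow_ne_zero _ hq)
  constructor
  · intro g
    have k0 := key 0 g
    rwa [h1, smul_zero, add_zero, mul_zero, zpow_zero, one_smul] at k0
  · intro g
    have := h1 (dilateHom hq 1 g)
    rwa [dilateHom_dilateHom, neg_add_cancel, dilateHom_zero] at this

/-- As `b ≠ i`, the reverse product is zero and the bracket is a single monomial. -/
lemma IsGradedModule.annihilates_mul (h : IsGradedModule q ρ 𝒱) (hq : q ≠ 0) {x : V}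
    {k s : ℤ} {i j b : Fin 2} (hbi : b ≠ i) (hks : k + s ≠ 0) {F G : ℂ[T;T⁻¹]}
    (hF : Annihilates ρ x k i j F) (hG : Annihilates ρ x s j b G) :
    Annihilates ρ x (k + s) i b (dilateHom hq s F * G) := by
  intro g
  have e := h.mon_mon_apply hq k s i j j b (1 * F) (g * G) x
  rw [hF, hG, if_pos rfl, if_neg hbi, psi_of_add_ne_zero q hks, one_mul] at e
  simp only [map_zero, smul_zero, zero_add, zero_smul, add_zero, sub_zero] at e
  rw [e]
  congr 3
  ring

/-- Degree `-1/2` generates the rest: `z⁻¹ M₁₂` with `z^{-s} M₂₁` gives both diagonal types at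
`z^{-s-1}`. Then `M₂₁` times the `M₁₁` type advances `M₂₁`, and the `M₁₁` type times `z⁻¹ M₁₂` gives
the further `M₁₂` types. -/
lemma IsGradedModule.mem_torsionVectors (h : IsGradedModule q ρ 𝒱) (hq : q ≠ 0)
    (hroot : ∀ s : ℕ, q ^ (s + 1) ≠ 1) {x : V} {F G : ℂ[T;T⁻¹]} (hF0 : F ≠ 0) (hG0 : G ≠ 0)
    (hF : Annihilates ρ x (-1) 0 1 F) (hG : Annihilates ρ x 0 1 0 G) : x ∈ torsionVectors ρ := by
  have h21 : ∀ s : ℕ, ∃ H, H ≠ 0 ∧ Annihilates ρ x (-s) 1 0 H := by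
    intro s
    induction s with
    | zero => exact ⟨G, hG0, by simpa using hG⟩
    | succ s ih =>
      obtain ⟨H, hH0, hH⟩ := ih
      have hD := (h.annihilates_diag hq (hroot s) hF hH).1
      have := h.annihilates_mul hq (by decide) (by omega) hG hD
      rw [zero_add] at this
      exact ⟨_, mul_ne_zero (dilateHom_ne_zero hq _ hG0)
        (mul_ne_zero (dilateHom_ne_zero hq _ hF0) hH0), this⟩
  have hdiag : ∀ (s : ℕ) (i : Fin 2), ∃ H, H ≠ 0 ∧ Annihilates ρ x (-(s + 1 : ℕ)) i i H := by
    intro s i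
    obtain ⟨H, hH0, hH⟩ := h21 s
    obtain ⟨h0, h1⟩ := h.annihilates_diag hq (hroot s) hF hH
    fin_cases i
    · exact ⟨_, mul_ne_zero (dilateHom_ne_zero hq _ hF0) hH0, h0⟩
    · exact ⟨_, mul_ne_zero (dilateHom_ne_zero hq _ hH0) hF0, h1⟩
  have h12 : ∀ s : ℕ, ∃ H, H ≠ 0 ∧ Annihilates ρ x (-(s + 1 : ℕ)) 0 1 H := by
    intro s
    rcases s with _ | s
    · exact ⟨F, hF0, by simpa using hF⟩
    · obtain ⟨H, hH0, hH⟩ := hdiag s 0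
      have := h.annihilates_mul hq (by decide) (by omega) hH hF
      rw [show (-((s + 1 : ℕ) : ℤ) + -1) = -((s + 1 + 1 : ℕ) : ℤ) by push_cast; ring] at this
      exact ⟨_, mul_ne_zero (dilateHom_ne_zero hq _ hH0) hF0, this⟩
  have hneg : ∀ k : ℤ, k < 0 → ∃ s : ℕ, k = -(s + 1 : ℕ) := fun k hk => ⟨(-k - 1).toNat, by omega⟩
  intro k i j hd
  fin_cases i <;> fin_cases j <;> simp only [deg] at hd
  · obtain ⟨s, rfl⟩ := hneg k (by simp at hd; omega)
    exact hdiag s 0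
  · obtain ⟨s, rfl⟩ := hneg k (by simp at hd; omega)
    exact h12 s
  · obtain ⟨s, rfl⟩ : ∃ s : ℕ, k = -s := ⟨(-k).toNat, by simp at hd; omega⟩
    exact h21 s
  · obtain ⟨s, rfl⟩ := hneg k (by simp at hd; omega)
    exact hdiag s 1

lemma IsIrreducibleHighestWeightModule.isQuasifinite
    (h : IsIrreducibleHighestWeightModule q lam ρ 𝒱) (hq : q ≠ 0)
    (hroot : ∀ s : ℕ, q ^ (s + 1) ≠ 1) {b₁₂ b₂₁ : ℂ[X]} (hb₁₂ : b₁₂ ≠ 0) (hb₂₁ : b₂₁ ≠ 0)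
    (h₁₂ : polyMul b₁₂ (rescale q⁻¹ (genSeries lam 0) + genSeries lam 1
      + constSeries (centralCharge lam)) = 0)
    (h₂₁ : polyMul b₂₁ (genSeries lam 0 + genSeries lam 1) = 0) : IsQuasifinite 𝒱 := by
  obtain ⟨v, hv⟩ := h.exists_isHighestWeightVector
  have hg := h.toIsGradedModule
  obtain ⟨hF, hG⟩ := hv.annihilates_of_polyMul_eq_zero h hq h₁₂ h₂₁
  have hvt : v ∈ torsionVectors ρ := hg.mem_torsionVectors hq hroot
    (Polynomial.toLaurent_ne_zero.2 hb₁₂) (Polynomial.toLaurent_ne_zero.2 hb₂₁) hF hG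
  refine hg.isQuasifinite_of_torsionVectors hv (eq_top_iff.2 fun x _ => ?_)
  exact hv.mem_of_stable _ hvt (fun k i j f hd y hy => hg.mon_mem_torsionVectors hq hy f hd) x

end Modules

end QPDO

end

open QPDO in
theorem mainTheorem1 (q : ℂ) (hq0 : q ≠ 0) (hq : ‖q‖ ≠ 1) (lam : Module.Dual ℂ (piece 0)) :
    (∀ (V : Type*) [AddCommGroup V] [Module ℂ V] (ρ : SSHat →ₗ[ℂ] Module.End ℂ V)
        (𝒱 : ℤ → Submodule ℂ V), IsIrreducibleHighestWeightModule q lam ρ 𝒱 →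
      (IsQuasifinite 𝒱 ↔
        ∃ b₁₂ b₂₁ : Polynomial ℂ, b₁₂.Monic ∧ b₂₁.Monic ∧
          polyMul b₁₂ (rescale q⁻¹ (genSeries lam 0) + genSeries lam 1
            + constSeries (centralCharge lam)) = 0 ∧
          polyMul b₂₁ (genSeries lam 0 + genSeries lam 1) = 0)) ∧
    ((∃ b₁₂ b₂₁ : Polynomial ℂ, b₁₂.Monic ∧ b₂₁.Monic ∧
        polyMul b₁₂ (rescale q⁻¹ (genSeries lam 0) + genSeries lam 1
          + constSeries (centralCharge lam)) = 0 ∧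
        polyMul b₂₁ (genSeries lam 0 + genSeries lam 1) = 0) ↔
      ∃ P₁₂ P₂₁ : ℂ → ℂ, IsQuasipolynomial P₁₂ ∧ IsQuasipolynomial P₂₁ ∧
        P₁₂ 0 = P₂₁ 0 + centralCharge lam ∧
        (∀ n : ℤ, P₂₁ n = label lam n 0 + label lam n 1) ∧
        (∀ n : ℤ, n ≠ 0 → P₁₂ n = q ^ n * label lam n 0 + label lam n 1)) := by
  -- The condition on `‖q‖` enters only through the fact that `q` is not a root of unity.
  have hroot : ∀ s : ℕ, q ^ (s + 1) ≠ 1 := fun s h =>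
    hq ((pow_eq_one_iff_of_nonneg (norm_nonneg q) s.succ_ne_zero).1 (by rw [← norm_pow, h, norm_one]))
  refine ⟨fun V _ _ ρ 𝒱 h => ⟨h.exists_polyMul_eq_zero hq0, ?_⟩,
    exists_polyMul_iff_exists_quasipolynomial q lam⟩
  rintro ⟨b₁₂, b₂₁, hb₁₂, hb₂₁, h₁₂, h₂₁⟩
  exact h.isQuasifinite hq0 hroot hb₁₂.ne_zero hb₂₁.ne_zero h₁₂ h₂₁
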